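/- A tournament is an orientation of a complete graph, and an oriented tree is an orientation of a finite tree. A leaf of an oriented tree is a vertex that is adjacent (in either direction) to at most one vertex. For a natural number $N$, a digraph is $N$-unavoidable if it is contained, as a (not necessarily induced) subdigraph, in every tournament with exactly $N$ vertices. Theorem. Let $A$ be an oriented tree with $n \ge 3$ vertices and $k$ leaves. Then $A$ is $\left\lceil \frac{9}{2} n - \frac{5}{2} k - \frac{9}{2} \right\rceil$-unavoidable. -/

import Mathlib

universe u v

namespace Digraph

/-- `D` is an orientation of the simple graph `G`: each edge of `G` is replaced by exactly one of
the two possible arcs between its ends. -/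
def IsOrientationOf {V : Type u} (D : Digraph V) (G : SimpleGraph V) : Prop :=
  (∀ x y, D.Adj x y → ¬ D.Adj y x) ∧ ∀ x y, G.Adj x y ↔ (D.Adj x y ∨ D.Adj y x)

/-- A tournament is an orientation of a complete graph. -/
def IsTournament {V : Type u} (D : Digraph V) : Prop :=
  D.IsOrientationOf (⊤ : SimpleGraph V)

/-- An oriented tree is an orientation of a tree. -/
def IsOrientedTree {V : Type u} (D : Digraph V) : Prop :=
  ∃ G : SimpleGraph V, G.IsTree ∧ D.IsOrientationOf G

/-- The leaves: the vertices adjacent (in either direction) to at most one vertex. -/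
def leaves {V : Type u} (D : Digraph V) : Set V :=
  {x | {y | D.Adj x y ∨ D.Adj y x}.Subsingleton}

/-- `D` is contained in `T` as a (not necessarily induced) subdigraph, up to isomorphism. -/
def IsContainedIn {V : Type u} {W : Type v} (D : Digraph V) (T : Digraph W) : Prop :=
  ∃ f : V → W, Function.Injective f ∧ ∀ x y, D.Adj x y → T.Adj (f x) (f y)

/-- `D` is `N`-unavoidable: it is contained in every tournament of order `N`. -/
def IsUnavoidable {V : Type u} (D : Digraph V) (N : ℕ) : Prop :=
  ∀ (W : Type v) [Fintype W] (T : Digraph W),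
    T.IsTournament → Fintype.card W = N → D.IsContainedIn T

end Digraph

/-!
Let `A` be an oriented tree with `n` vertices and `k` leaves, and let its core be the subtree formed by
the `m = n - k` vertices that are not leaves. The core is embedded first, in an interval of a median
order of the tournament, and then all leaves at once by Hall's theorem. This needs only
`4 (m - 1) + 2 k` vertices, which is at most the number in the theorem.

In a median order each vertex dominates at least half of every interval starting right after it, and
is dominated by at least half of every interval ending right before it (`exists_median_order`).
Assigning the vertices of a median order one after another, each to a child of the earliest node
dominating it that still has children to embed, embeds every arborescence with `b` vertices and `l`
leaves in every tournament with `b + l - 1` vertices (`exists_arborescence_embedding`).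

Root the core. An arc is forward if it is directed away from the root, and backward otherwise. The
components of the backward arcs, the blocks, are in-arborescences joined by forward arcs. The blocks
are embedded one at a time, each among `b + l - 1` unused out-neighbours of the image of the parent of
its top; the median property supplies these if the window is lengthened by twice as much
(`Controlled.exists_out_neighbors`). In total the window has length
`2 (m + #{vertices without backward child} - #blocks - 1)`. Adding this to the corresponding length
for the reversed core gives at most `4 (m - 1) + 2 (c - 1)`, where `c` is the number of childless
vertices of the core; so, up to reversing all arcs, the window has length at most
`2 (m - 1) + c - 1`.

The window is placed so that twice the number of out-leaves remains behind it. In Hall's condition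
(`exists_leaf_positions`) the critical sets of leaves have the parents `X` of their out-leaves all
before the parents `Y` of their in-leaves. The common neighbours that are then counted twice lie
strictly between `X` and `Y`, hence are fewer if `X ∪ Y` is large, while the set of leaves is small if
`X ∪ Y` is small, because every childless vertex of the core carries a leaf.

A rooted tree is encoded by its root `r`, a parent map `π` that decreases a rank away from `r` (its
value at `r` is irrelevant), and the predicate `fwd` saying that the arc from `π u` to `u` is forward.
-/

open Finset

/-! ### Median orders -/

open Classical in
/-- The number of pairs of entries of a list, in the order of the list, that are related by `T`. -/
noncomputable def forwardCount {α : Type*} (T : α → α → Prop) : List α → ℕ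
  | [] => 0
  | x :: l => l.countP (fun y => decide (T x y)) + forwardCount T l

open Classical in
/-- The number of `T`-related pairs with first entry in `l₁` and second entry in `l₂`. -/
noncomputable def crossCount {α : Type*} (T : α → α → Prop) (l₁ l₂ : List α) : ℕ :=
  (l₁.map fun x => l₂.countP (fun y => decide (T x y))).sum

theorem crossCount_append_right {α : Type*} (T : α → α → Prop) (l l₁ l₂ : List α) :
    crossCount T l (l₁ ++ l₂) = crossCount T l l₁ + crossCount T l l₂ := by
  simp [crossCount, List.sum_map_add]

theorem forwardCount_append {α : Type*} (T : α → α → Prop) (l₁ l₂ : List α) :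
    forwardCount T (l₁ ++ l₂) = forwardCount T l₁ + crossCount T l₁ l₂ + forwardCount T l₂ := by
  induction l₁ with
  | nil => simp [forwardCount, crossCount]
  | cons x l ih =>
    simp only [List.cons_append, forwardCount, List.countP_append, ih, crossCount, List.map_cons,
      List.sum_cons]
    ring

open Classical in
theorem crossCount_singleton_right {α : Type*} (T : α → α → Prop) (l : List α) (x : α) :
    crossCount T l [x] = l.countP (fun y => decide (T y x)) := by
  induction l with
  | nil => simp [crossCount]
  | cons y l ih =>
    simp only [crossCount, List.map_cons, List.sum_cons, List.countP_cons] at ih ⊢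
    rw [ih]
    simp
    ring

open Classical in
theorem countP_take_drop {α : Type*} (q : α → Prop) (d : α) (l : List α) (a b : ℕ)
    (h : a + b ≤ l.length) :
    ((l.drop a).take b).countP (fun y => decide (q y)) =
      #{t ∈ Finset.Ico a (a + b) | q (l.getD t d)} := by
  induction b with
  | zero => simp
  | succ b ih =>
    have hlt : a + b < l.length := by omega
    have hIco : Finset.Ico a (a + (b + 1)) = insert (a + b) (Finset.Ico a (a + b)) := by
      ext t
      simp only [Finset.mem_Ico, Finset.mem_insert]
      omega
    rw [List.take_add_one, List.countP_append, ih (by omega), hIco, Finset.filter_insert]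
    have hget : (l.drop a)[b]? = some l[a + b] := by
      rw [List.getElem?_drop, List.getElem?_eq_getElem hlt]
    rw [hget, List.getD_eq_getElem _ _ hlt]
    by_cases hq : q l[a + b]
    · simp [hq]
    · simp [hq]

theorem countP_add_countP_ge {α : Type*} (p q : α → Bool) (l : List α)
    (h : ∀ y ∈ l, p y = true ∨ q y = true) : l.length ≤ l.countP p + l.countP q := by
  induction l with
  | nil => simp
  | cons y l ih =>
    have h1 := ih fun y hy => h y (List.mem_cons_of_mem _ hy)
    have h2 := h y List.mem_cons_self
    simp only [List.length_cons, List.countP_cons]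
    rcases h2 with h2 | h2 <;> simp only [h2, if_true] <;> omega

open Classical in
/-- Every finite tournament has a median order: an enumeration in which each vertex dominates at
least half of every interval starting right after it, and is dominated by at least half of every
interval ending right before it. An enumeration with the most forward arcs has this property, since
moving a vertex across an interval cannot increase the number of forward arcs. -/
theorem exists_median_order {α : Type*} [Nonempty α] (T : α → α → Prop) (P : Finset α)
    (hT : ∀ a ∈ P, ∀ b ∈ P, a ≠ b → T a b ∨ T b a) :
    ∃ p : ℕ → α, (∀ i < #P, p i ∈ P) ∧ (∀ i < #P, ∀ j < #P, p i = p j → i = j) ∧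
      (∀ i j, i < j → j < #P → j - i ≤ 2 * #{t ∈ Finset.Ioc i j | T (p i) (p t)}) ∧
      (∀ i j, i < j → j < #P → j - i ≤ 2 * #{t ∈ Finset.Ico i j | T (p t) (p j)}) := by
  obtain ⟨d⟩ := ‹Nonempty α›
  obtain ⟨l, hl, hmax⟩ := Finset.exists_max_image P.toList.permutations.toFinset (forwardCount T)
    ⟨P.toList, by simp⟩
  simp only [List.mem_toFinset, List.mem_permutations] at hl hmax
  have hnd : l.Nodup := hl.nodup_iff.2 P.nodup_toList
  have hmem : ∀ a ∈ l, a ∈ P := fun a ha => Finset.mem_toList.1 (hl.mem_iff.1 ha)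
  have hlen : l.length = #P := by rw [hl.length_eq, Finset.length_toList]
  -- Compare `l` with the list in which `x` has been moved across `l₂`.
  have hmove : ∀ (l₁ l₂ l₃ : List α) (x : α), l = l₁ ++ ([x] ++ (l₂ ++ l₃)) →
      crossCount T l₂ [x] ≤ crossCount T [x] l₂ := by
    intro l₁ l₂ l₃ x h
    have h1 := hmax (l₁ ++ (l₂ ++ ([x] ++ l₃))) (by
      refine List.Perm.trans ?_ hl
      rw [h]
      refine List.Perm.append_left _ ?_
      rw [← List.append_assoc, ← List.append_assoc]
      exact List.Perm.append_right _ List.perm_append_comm)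
    rw [h] at h1
    simp only [forwardCount_append, crossCount_append_right] at h1
    omega
  have hmove' : ∀ (l₁ l₂ l₃ : List α) (x : α), l = l₁ ++ (l₂ ++ ([x] ++ l₃)) →
      crossCount T [x] l₂ ≤ crossCount T l₂ [x] := by
    intro l₁ l₂ l₃ x h
    have h1 := hmax (l₁ ++ ([x] ++ (l₂ ++ l₃))) (by
      refine List.Perm.trans ?_ hl
      rw [h]
      refine List.Perm.append_left _ ?_
      rw [← List.append_assoc, ← List.append_assoc]
      exact List.Perm.append_right _ List.perm_append_comm)
    rw [h] at h1
    simp only [forwardCount_append, crossCount_append_right] at h1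
    omega
  have hsum : ∀ (l₂ : List α) (x : α), (∀ y ∈ l₂, y ∈ l ∧ x ≠ y) → x ∈ l →
      l₂.length ≤ crossCount T [x] l₂ + crossCount T l₂ [x] := by
    intro l₂ x h hx
    rw [crossCount_singleton_right]
    have := countP_add_countP_ge (fun y => decide (T x y)) (fun y => decide (T y x)) l₂ (by
      intro y hy
      simpa using hT x (hmem x hx) y (hmem y (h y hy).1) (h y hy).2)
    simpa [crossCount] using this
  refine ⟨fun i => l.getD i d, ?_, ?_, ?_, ?_⟩
  · intro i hi
    rw [← hlen] at hi
    dsimp only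
    rw [List.getD_eq_getElem _ _ hi]
    exact hmem _ (List.getElem_mem hi)
  · intro i hi j hj hij
    rw [← hlen] at hi hj
    dsimp only at hij
    rw [List.getD_eq_getElem _ _ hi, List.getD_eq_getElem _ _ hj] at hij
    exact (hnd.getElem_inj_iff).1 hij
  · intro i j hij hj
    rw [← hlen] at hj
    have hi : i < l.length := by omega
    have hdec : l = l.take i ++ ([l[i]] ++ ((l.drop (i + 1)).take (j - i) ++ l.drop (j + 1))) := by
      conv_lhs => rw [← List.take_append_drop i l, List.drop_eq_getElem_cons hi,
        ← List.take_append_drop (j - i) (l.drop (i + 1)), List.drop_drop]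
      rw [show i + 1 + (j - i) = j + 1 by omega]
      rfl
    have hnd' := hnd
    rw [hdec] at hnd'
    have h1 := hmove _ _ _ _ hdec
    have h2 := hsum ((l.drop (i + 1)).take (j - i)) l[i] (by
      intro y hy
      refine ⟨List.mem_of_mem_drop (List.mem_of_mem_take hy), ?_⟩
      rintro rfl
      have := (List.nodup_append.1 hnd').2.1
      rw [List.singleton_append, List.nodup_cons] at this
      exact this.1 (List.mem_append_left _ hy)) (List.getElem_mem hi)
    have h3 : crossCount T [l[i]] ((l.drop (i + 1)).take (j - i)) =
        #{t ∈ Finset.Ioc i j | T (l.getD i d) (l.getD t d)} := by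
      have := countP_take_drop (T l[i]) d l (i + 1) (j - i) (by omega)
      rw [List.getD_eq_getElem _ _ hi]
      simp only [crossCount, List.map_cons, List.map_nil, List.sum_singleton, this]
      congr 1
      ext t
      simp only [Finset.mem_filter, Finset.mem_Ico, Finset.mem_Ioc]
      constructor <;> rintro ⟨h, h'⟩ <;> exact ⟨by omega, h'⟩
    have h4 : ((l.drop (i + 1)).take (j - i)).length = j - i := by simp; omega
    dsimp only
    omega
  · intro i j hij hj
    rw [← hlen] at hj
    have hdec : l = l.take i ++ ((l.drop i).take (j - i) ++ ([l[j]] ++ l.drop (j + 1))) := by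
      conv_lhs => rw [← List.take_append_drop i l, ← List.take_append_drop (j - i) (l.drop i),
        List.drop_drop, show i + (j - i) = j by omega, List.drop_eq_getElem_cons hj]
      rfl
    have hnd' := hnd
    rw [hdec] at hnd'
    have h1 := hmove' _ _ _ _ hdec
    have h2 := hsum ((l.drop i).take (j - i)) l[j] (by
      intro y hy
      refine ⟨List.mem_of_mem_drop (List.mem_of_mem_take hy), ?_⟩
      rintro rfl
      have := (List.nodup_append.1 (List.nodup_append.1 hnd').2.1).2.2
      exact this _ hy _ (List.mem_append_left _ (List.mem_singleton_self _)) rfl) (List.getElem_mem hj)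
    have h3 : crossCount T ((l.drop i).take (j - i)) [l[j]] =
        #{t ∈ Finset.Ico i j | T (l.getD t d) (l.getD j d)} := by
      have := countP_take_drop (fun y => T y l[j]) d l i (j - i) (by omega)
      rw [List.getD_eq_getElem _ _ hj, crossCount_singleton_right, this,
        show i + (j - i) = j by omega]
    have h4 : ((l.drop i).take (j - i)).length = j - i := by simp; omega
    dsimp only
    omega

/-! ### Arborescences -/

theorem card_filter_add_card_filter_of_iff_not {α : Type*} (s : Finset α) (p q : α → Prop)
    [DecidablePred p] [DecidablePred q] (h : ∀ x ∈ s, q x ↔ ¬ p x) :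
    #{x ∈ s | p x} + #{x ∈ s | q x} = #s := by
  classical
  rw [Finset.filter_congr h, Finset.card_filter_add_card_filter_not]

open Classical in
/-- State of the scan of a median order after `i` vertices, for an arborescence with node set `B`,
root `z` and parent map `π`. `E` is the set of embedded nodes and `f` gives their positions; a node is
open when it is embedded and one of its children is not. A scanned vertex is assigned to a child of
the earliest open node that dominates it, and is left unused if there is none. The field `fail`
records the second half of this rule, `first` the choice of the earliest node, and `count` bounds the
unused vertices of each initial interval by the embedded leaves in it. -/
structure ScanState {β : Type*} (R : ℕ → ℕ → Prop) (B : Finset β) (z : β) (π : β → β)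
    (i : ℕ) (E : Finset β) (f : β → ℕ) : Prop where
  sub : E ⊆ B
  root : z ∈ E
  parent : ∀ u ∈ E, u ≠ z → π u ∈ E
  lt : ∀ u ∈ E, f u < i
  inj : ∀ u ∈ E, ∀ v ∈ E, f u = f v → u = v
  arc : ∀ u ∈ E, u ≠ z → R (f (π u)) (f u)
  arc_lt : ∀ u ∈ E, u ≠ z → f (π u) < f u
  fail : ∀ u ∈ E, (∃ c ∈ B, c ∉ E ∧ c ≠ z ∧ π c = u) →
    ∀ g, f u < g → g < i → (∀ v ∈ E, f v ≠ g) → ¬ R (f u) g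
  first : ∀ u ∈ E, (∃ c ∈ B, c ∉ E ∧ c ≠ z ∧ π c = u) →
    ∀ c ∈ E, c ≠ z → f u < f (π c) → ¬ R (f u) (f c)
  count : ∀ j ≤ i, #{g ∈ range j | ∀ v ∈ E, f v ≠ g} ≤
    #{u ∈ E | (∀ c ∈ B, c ≠ z → π c ≠ u) ∧ f u < j}

open Classical in
/-- The key estimate: after the position of the last open node `w`, the vertices left unused are no
more numerous than the embedded leaves. Indeed each embedded inner node after `w` has all its
children embedded, and none of them is dominated by `w`, by the rule of the scan; so at least as
many embedded nodes escape `w` as there are inner nodes, while `w` dominates half of the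
interval. -/
theorem ScanState.card_unused_le {β : Type*} {R : ℕ → ℕ → Prop} {B : Finset β} {z : β} {π : β → β}
    {i : ℕ} {E : Finset β} {f : β → ℕ} (S : ScanState R B z π i E f) {w : β} (hw : w ∈ E)
    (hopen : ∃ c ∈ B, c ∉ E ∧ c ≠ z ∧ π c = w)
    (hlast : ∀ u ∈ E, (∃ c ∈ B, c ∉ E ∧ c ≠ z ∧ π c = u) → f u ≤ f w)
    (hmed : i - f w ≤ 2 * #{t ∈ Finset.Ioc (f w) i | R (f w) t}) (hi : ¬ R (f w) i) :
    #{g ∈ Finset.Ioc (f w) i | ∀ v ∈ E, f v ≠ g} ≤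
      #{u ∈ E | (∀ c ∈ B, c ≠ z → π c ≠ u) ∧ f w < f u} := by
  set EI := {u ∈ E | f w < f u} with hEI
  set LI := {u ∈ E | (∀ c ∈ B, c ≠ z → π c ≠ u) ∧ f w < f u} with hLI
  set II := {u ∈ EI | ∃ c ∈ B, c ≠ z ∧ π c = u} with hII
  set Q := {u ∈ EI | R (f w) (f u)} with hQ
  set F := {g ∈ Finset.Ioc (f w) i | ∀ v ∈ E, f v ≠ g} with hF
  have hsplit : #LI + #II = #EI := by
    have : {u ∈ EI | ∀ c ∈ B, c ≠ z → π c ≠ u} = LI := by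
      ext u
      simp only [hEI, hLI, mem_filter]
      tauto
    rw [← this]
    refine card_filter_add_card_filter_of_iff_not _ _ _ fun u _ => ?_
    push Not
    rfl
  have hsplit2 : #Q + #{u ∈ EI | ¬ R (f w) (f u)} = #EI :=
    card_filter_add_card_filter_of_iff_not _ _ _ fun u _ => Iff.rfl
  have hint : #II ≤ #{u ∈ EI | ¬ R (f w) (f u)} := by
    have hch : ∀ u ∈ II, ∃ c, c ∈ B ∧ c ≠ z ∧ π c = u := fun u hu => (mem_filter.1 hu).2
    choose! ch hchB hchz hchπ using hch
    have hchE : ∀ u ∈ II, ch u ∈ E := by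
      intro u hu
      by_contra hcon
      have h1 := mem_filter.1 (mem_filter.1 hu).1
      have := hlast u h1.1 ⟨ch u, hchB u hu, hcon, hchz u hu, hchπ u hu⟩
      omega
    refine Finset.card_le_card_of_injOn ch ?_ ?_
    · intro u hu
      have h1 := mem_filter.1 (mem_filter.1 hu).1
      have h2 := S.arc_lt _ (hchE u hu) (hchz u hu)
      rw [hchπ u hu] at h2
      simp only [hEI, coe_filter, mem_filter, Set.mem_ofPred_eq]
      refine ⟨⟨hchE u hu, by omega⟩, S.first w hw hopen _ (hchE u hu) (hchz u hu) ?_⟩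
      rw [hchπ u hu]
      exact h1.2
    · intro u hu v hv huv
      rw [← hchπ u hu, ← hchπ v hv, huv]
  have hIoc : #F + #EI ≤ i - f w := by
    have h1 : #F + #{g ∈ Finset.Ioc (f w) i | ¬ ∀ v ∈ E, f v ≠ g} = i - f w := by
      rw [← Nat.card_Ioc]
      exact card_filter_add_card_filter_of_iff_not _ _ _ fun u _ => Iff.rfl
    have h2 : #EI ≤ #{g ∈ Finset.Ioc (f w) i | ¬ ∀ v ∈ E, f v ≠ g} := by
      refine Finset.card_le_card_of_injOn f ?_ ?_
      · intro u hu
        have hu := mem_filter.1 hu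
        have := S.lt u hu.1
        simp only [coe_filter, mem_Ioc, Set.mem_ofPred_eq]
        refine ⟨⟨hu.2, this.le⟩, fun h => h u hu.1 rfl⟩
      · intro u hu v hv huv
        exact S.inj u (mem_filter.1 hu).1 v (mem_filter.1 hv).1 huv
    omega
  have hdom : #{t ∈ Finset.Ioc (f w) i | R (f w) t} ≤ #Q := by
    refine le_trans (Finset.card_le_card ?_) (Finset.card_image_le (s := Q) (f := f))
    intro t ht
    simp only [mem_filter, mem_Ioc] at ht
    have hti : t ≠ i := fun h => hi (h ▸ ht.2)
    have : ∃ v ∈ E, f v = t := by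
      by_contra! hcon
      exact S.fail w hw hopen t ht.1.1 (by omega) hcon ht.2
    obtain ⟨v, hv, rfl⟩ := this
    exact mem_image_of_mem f (by simp only [hQ, hEI, mem_filter]; exact ⟨⟨hv, ht.1.1⟩, ht.2⟩)
  omega

open Classical in
/-- A partial embedding of an arborescence has an open node. -/
theorem exists_open_node {β : Type*} {B E : Finset β} {z : β} {π : β → β} {rank : β → ℕ}
    (hz : z ∈ E) (hπ : ∀ u ∈ B, u ≠ z → π u ∈ B ∧ rank (π u) < rank u)
    (hE : ∃ c ∈ B, c ∉ E) : ∃ u ∈ E, ∃ c ∈ B, c ∉ E ∧ c ≠ z ∧ π c = u := by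
  obtain ⟨c₀, hc₀, hc₀E⟩ := hE
  obtain ⟨c, hc, hmin⟩ := Finset.exists_min_image (B \ E) rank ⟨c₀, by simp [hc₀, hc₀E]⟩
  rw [mem_sdiff] at hc
  have hcz : c ≠ z := fun h => hc.2 (h ▸ hz)
  have h := hπ c hc.1 hcz
  refine ⟨π c, ?_, c, hc.1, hc.2, hcz, rfl⟩
  by_contra hcon
  have := hmin (π c) (by simp [h.1, hcon])
  omega

open Classical in
/-- The scan can be carried on until all nodes are embedded or all vertices are scanned. -/
theorem exists_scanState {β : Type*} (R : ℕ → ℕ → Prop) (n : ℕ)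
    (hmed : ∀ i j, i < j → j < n → j - i ≤ 2 * #{t ∈ Finset.Ioc i j | R i t})
    (B : Finset β) (z : β) (hz : z ∈ B) (π : β → β) (rank : β → ℕ)
    (hπ : ∀ u ∈ B, u ≠ z → π u ∈ B ∧ rank (π u) < rank u) (i : ℕ) (hi : i + 1 ≤ n) :
    ∃ E f, (E = B ∧ (∀ u ∈ B, f u < n) ∧ (∀ u ∈ B, ∀ v ∈ B, f u = f v → u = v) ∧
      ∀ u ∈ B, u ≠ z → R (f (π u)) (f u)) ∨ ScanState R B z π (i + 1) E f := by
  induction i with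
  | zero =>
    refine ⟨{z}, fun _ => 0, Or.inr ⟨by simpa using hz, by simp, by simp, by simp, by simp, ?_, ?_,
      ?_, ?_, ?_⟩⟩
    · simp
    · simp
    · intro u _ _ g hg hg' _
      omega
    · simp
    · intro j hj
      have : {g ∈ range j | ∀ v ∈ ({z} : Finset β), (0 : ℕ) ≠ g} = ∅ := by
        ext g
        simp only [mem_filter, mem_range, mem_singleton, forall_eq, notMem_empty, iff_false]
        omega
      rw [this]
      simp
  | succ i ih =>
    obtain ⟨E, f, hEf | S⟩ := ih (by omega)
    · exact ⟨E, f, Or.inl hEf⟩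
    set k := i + 1 with hk
    by_cases hEB : E = B
    · subst hEB
      exact ⟨E, f, Or.inl ⟨rfl, fun u hu => (S.lt u hu).trans_le (by omega), S.inj, S.arc⟩⟩
    have hne : ∃ c ∈ B, c ∉ E := by
      by_contra! hcon
      exact hEB (Finset.Subset.antisymm S.sub hcon)
    by_cases hex : ∃ u ∈ E, (∃ c ∈ B, c ∉ E ∧ c ≠ z ∧ π c = u) ∧ R (f u) k
    -- Vertex `k` goes to a child of the earliest open node dominating it.
    · obtain ⟨u₀, hu₀⟩ := hex
      obtain ⟨u, hu, hmin⟩ := Finset.exists_min_image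
        {u ∈ E | (∃ c ∈ B, c ∉ E ∧ c ≠ z ∧ π c = u) ∧ R (f u) k} f ⟨u₀, by simpa using hu₀⟩
      rw [mem_filter] at hu
      obtain ⟨huE, ⟨c, hcB, hcE, hcz, rfl⟩, hR⟩ := hu
      have hfc : ∀ v ∈ E, Function.update f c k v = f v := by
        intro v hv
        rw [Function.update_of_ne]
        rintro rfl
        exact hcE hv
      have hfc' : Function.update f c k c = k := Function.update_self ..
      have hopen : ∀ u, (∃ c' ∈ B, c' ∉ insert c E ∧ c' ≠ z ∧ π c' = u) →
          ∃ c' ∈ B, c' ∉ E ∧ c' ≠ z ∧ π c' = u := by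
        rintro u ⟨c', h1, h2, h3, h4⟩
        exact ⟨c', h1, fun h => h2 (mem_insert_of_mem h), h3, h4⟩
      refine ⟨insert c E, Function.update f c k, Or.inr ⟨?_, ?_, ?_, ?_, ?_, ?_, ?_, ?_, ?_, ?_⟩⟩
      · exact insert_subset hcB S.sub
      · exact mem_insert_of_mem S.root
      · intro v hv hvz
        rcases mem_insert.1 hv with rfl | hv
        · exact mem_insert_of_mem huE
        · exact mem_insert_of_mem (S.parent v hv hvz)
      · intro v hv
        rcases mem_insert.1 hv with rfl | hv
        · rw [hfc']; omega
        · rw [hfc v hv]; have := S.lt v hv; omega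
      · intro v hv v' hv' h
        rw [mem_insert] at hv hv'
        rcases hv with rfl | hv <;> rcases hv' with rfl | hv'
        · rfl
        · rw [hfc', hfc v' hv'] at h
          have := S.lt v' hv'
          omega
        · rw [hfc', hfc v hv] at h
          have := S.lt v hv
          omega
        · rw [hfc v hv, hfc v' hv'] at h
          exact S.inj v hv v' hv' h
      · intro v hv hvz
        rcases mem_insert.1 hv with rfl | hv
        · rw [hfc', hfc _ huE]; exact hR
        · rw [hfc v hv, hfc _ (S.parent v hv hvz)]; exact S.arc v hv hvz
      · intro v hv hvz
        rcases mem_insert.1 hv with rfl | hv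
        · rw [hfc', hfc _ huE]; exact S.lt _ huE
        · rw [hfc v hv, hfc _ (S.parent v hv hvz)]; exact S.arc_lt v hv hvz
      · intro v hv ho g hg hg' hun
        rcases mem_insert.1 hv with rfl | hv
        · rw [hfc'] at hg; omega
        · rw [hfc v hv] at hg ⊢
          have hgk : g ≠ k := by
            rintro rfl
            exact hun c (mem_insert_self ..) hfc'
          refine S.fail v hv (hopen v ho) g hg (by omega) fun v' hv' => ?_
          rw [← hfc v' hv']
          exact hun v' (mem_insert_of_mem hv')
      · intro v hv ho c' hc' hc'z hlt
        rcases mem_insert.1 hc' with rfl | hc'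
        · rw [hfc _ huE] at hlt
          rcases mem_insert.1 hv with rfl | hv
          · rw [hfc'] at hlt
            have := S.lt _ huE
            omega
          · rw [hfc v hv] at hlt ⊢
            rw [hfc']
            intro hcon
            have := hmin v (by rw [mem_filter]; exact ⟨hv, hopen v ho, hcon⟩)
            omega
        · have hpe := S.parent c' hc' hc'z
          rw [hfc _ hpe] at hlt
          rw [hfc c' hc']
          rcases mem_insert.1 hv with rfl | hv
          · rw [hfc'] at hlt
            have := S.lt _ hpe
            omega
          · rw [hfc v hv] at hlt ⊢
            exact S.first v hv (hopen v ho) c' hc' hc'z hlt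
      · intro j hj
        have h1 := S.count (min j k) (min_le_right ..)
        refine le_trans (Finset.card_le_card ?_) (h1.trans (Finset.card_le_card ?_))
        · intro g hg
          simp only [mem_filter, mem_range] at hg ⊢
          have hgk : k ≠ g := by
            have := hg.2 c (mem_insert_self ..)
            rwa [hfc'] at this
          refine ⟨by omega, fun v hv => ?_⟩
          rw [← hfc v hv]
          exact hg.2 v (mem_insert_of_mem hv)
        · intro v hv
          simp only [mem_filter] at hv ⊢
          refine ⟨mem_insert_of_mem hv.1, hv.2.1, ?_⟩
          rw [hfc v hv.1]
          omega
    -- No open node dominates vertex `k`, which stays unused. The bound on the unused vertices comes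
    -- from the invariant up to the last open node `w`, and from `card_unused_le` after `w`.
    · push Not at hex
      refine ⟨E, f, Or.inr ⟨S.sub, S.root, S.parent, fun u hu => (S.lt u hu).trans (by omega),
        S.inj, S.arc, S.arc_lt, ?_, S.first, ?_⟩⟩
      · intro u hu ho g hg hg' hun
        by_cases hgk : g = k
        · subst hgk; exact hex u hu ho
        · exact S.fail u hu ho g hg (by omega) hun
      · intro j hj
        rcases Nat.lt_or_ge k j with hjk | hjk
        swap
        · exact S.count j hjk
        obtain rfl : j = k + 1 := by omega
        obtain ⟨u₀, hu₀, ho₀⟩ := exists_open_node S.root hπ hne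
        obtain ⟨w, hw, hmax⟩ := Finset.exists_max_image
          {u ∈ E | ∃ c ∈ B, c ∉ E ∧ c ≠ z ∧ π c = u} f ⟨u₀, by rw [mem_filter]; exact ⟨hu₀, ho₀⟩⟩
        rw [mem_filter] at hw
        have hwk := S.lt w hw.1
        have h1 := S.card_unused_le hw.1 hw.2
          (fun u hu ho => hmax u (by rw [mem_filter]; exact ⟨hu, ho⟩))
          (hmed (f w) k hwk (by omega)) (hex w hw.1 hw.2)
        have h2 := S.count (f w + 1) hwk
        have h3 : {g ∈ range (k + 1) | ∀ v ∈ E, f v ≠ g} ⊆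
            {g ∈ range (f w + 1) | ∀ v ∈ E, f v ≠ g} ∪
              {g ∈ Finset.Ioc (f w) k | ∀ v ∈ E, f v ≠ g} := by
          intro g hg
          simp only [mem_union, mem_filter, mem_range, mem_Ioc] at hg ⊢
          rcases Nat.lt_or_ge (f w) g with h | h
          · exact Or.inr ⟨⟨h, by omega⟩, hg.2⟩
          · exact Or.inl ⟨by omega, hg.2⟩
        have h4 : {u ∈ E | (∀ c ∈ B, c ≠ z → π c ≠ u) ∧ f u < f w + 1} ∪
            {u ∈ E | (∀ c ∈ B, c ≠ z → π c ≠ u) ∧ f w < f u} ⊆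
              {u ∈ E | (∀ c ∈ B, c ≠ z → π c ≠ u) ∧ f u < k + 1} := by
          intro u hu
          simp only [mem_union, mem_filter] at hu ⊢
          have := S.lt u (by tauto)
          refine ⟨by tauto, by tauto, by omega⟩
        have h5 : Disjoint {u ∈ E | (∀ c ∈ B, c ≠ z → π c ≠ u) ∧ f u < f w + 1}
            {u ∈ E | (∀ c ∈ B, c ≠ z → π c ≠ u) ∧ f w < f u} := by
          rw [Finset.disjoint_left]
          intro u hu hu'
          simp only [mem_filter] at hu hu'
          omega
        have h6 := Finset.card_le_card h3
        have h7 := Finset.card_le_card h4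
        rw [Finset.card_union_of_disjoint h5] at h7
        have h8 := Finset.card_union_le {g ∈ range (f w + 1) | ∀ v ∈ E, f v ≠ g}
          {g ∈ Finset.Ioc (f w) k | ∀ v ∈ E, f v ≠ g}
        omega

open Classical in
/-- Every arborescence with vertex set `B`, root `z` and `l` leaves is contained in every tournament
with at least `#B + l - 1` vertices. -/
theorem exists_arborescence_embedding {α β : Type*} [Nonempty α] (T : α → α → Prop) (P : Finset α)
    (hT : ∀ a ∈ P, ∀ b ∈ P, a ≠ b → T a b ∨ T b a)
    (B : Finset β) (z : β) (hz : z ∈ B) (π : β → β) (rank : β → ℕ)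
    (hπ : ∀ u ∈ B, u ≠ z → π u ∈ B ∧ rank (π u) < rank u)
    (hcard : #B + #{u ∈ B | ∀ c ∈ B, c ≠ z → π c ≠ u} ≤ #P + 1) :
    ∃ f : β → α, (∀ u ∈ B, f u ∈ P) ∧ (∀ u ∈ B, ∀ v ∈ B, f u = f v → u = v) ∧
      ∀ u ∈ B, u ≠ z → T (f (π u)) (f u) := by
  obtain ⟨p, hpP, hpinj, hmed, -⟩ := exists_median_order T P hT
  -- A node of maximal rank among given nodes of `B` has no child among them.
  have hleaf : ∀ s ⊆ B, s.Nonempty → ∃ u ∈ s, ∀ c ∈ s, c ≠ z → π c ≠ u := by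
    intro s hs hne
    obtain ⟨u, hu, hmax⟩ := Finset.exists_max_image s rank hne
    refine ⟨u, hu, ?_⟩
    rintro c hc hcz rfl
    have := hmax c hc
    have := (hπ c (hs hc) hcz).2
    omega
  have hPpos : 1 ≤ #P := by
    obtain ⟨u, hu, hu'⟩ := hleaf B subset_rfl ⟨z, hz⟩
    have h1 : 0 < #B := Finset.card_pos.2 ⟨z, hz⟩
    have h2 : 0 < #{u ∈ B | ∀ c ∈ B, c ≠ z → π c ≠ u} :=
      Finset.card_pos.2 ⟨u, by rw [mem_filter]; exact ⟨hu, hu'⟩⟩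
    omega
  obtain ⟨E, f, h⟩ := exists_scanState (fun i j => T (p i) (p j)) #P hmed B z hz π rank hπ
    (#P - 1) (by omega)
  rw [show #P - 1 + 1 = #P by omega] at h
  have hfin : E = B ∧ (∀ u ∈ B, f u < #P) ∧ (∀ u ∈ B, ∀ v ∈ B, f u = f v → u = v) ∧
      ∀ u ∈ B, u ≠ z → T (p (f (π u))) (p (f u)) := by
    rcases h with h | S
    · exact h
    by_cases hEB : E = B
    · subst hEB
      exact ⟨rfl, S.lt, S.inj, S.arc⟩
    -- Otherwise a node and a leaf are missing from `E`, and the scanned vertices are too few.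
    exfalso
    have hss : E ⊂ B := Finset.ssubset_iff_subset_ne.2 ⟨S.sub, hEB⟩
    have h1 := Finset.card_lt_card hss
    have h2 := S.count #P le_rfl
    have h3 : #P = #{g ∈ range #P | ∀ v ∈ E, f v ≠ g} + #E := by
      have h := Finset.card_filter_add_card_filter_not (s := range #P) (fun g => ∀ v ∈ E, f v ≠ g)
      have h' : {g ∈ range #P | ¬ ∀ v ∈ E, f v ≠ g} = E.image f := by
        ext g
        simp only [mem_filter, mem_range, mem_image]
        push Not
        constructor
        · rintro ⟨-, v, hv⟩; exact ⟨v, hv⟩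
        · rintro ⟨v, hv, rfl⟩; exact ⟨S.lt v hv, v, hv, rfl⟩
      rw [h', Finset.card_image_of_injOn (fun u hu v hv => S.inj u hu v hv), card_range] at h
      exact h.symm
    have h4 : #{u ∈ E | (∀ c ∈ B, c ≠ z → π c ≠ u) ∧ f u < #P} <
        #{u ∈ B | ∀ c ∈ B, c ≠ z → π c ≠ u} := by
      refine Finset.card_lt_card (Finset.ssubset_iff_subset_ne.2 ⟨?_, ?_⟩)
      · intro u hu
        rw [mem_filter] at hu ⊢
        exact ⟨S.sub hu.1, hu.2.1⟩
      · intro heq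
        obtain ⟨u, hu, hu'⟩ := hleaf (B \ E) sdiff_subset
          (Finset.sdiff_nonempty.2 (fun h => hEB (Finset.Subset.antisymm S.sub h)))
        rw [mem_sdiff] at hu
        have : u ∈ {u ∈ B | ∀ c ∈ B, c ≠ z → π c ≠ u} := by
          rw [mem_filter]
          refine ⟨hu.1, ?_⟩
          rintro c hc hcz rfl
          refine hu' c ?_ hcz rfl
          rw [mem_sdiff]
          exact ⟨hc, fun hcE => hu.2 (S.parent c hcE hcz)⟩
        rw [← heq, mem_filter] at this
        exact hu.2 this.1
    omega
  refine ⟨fun u => p (f u), fun u hu => hpP _ (hfin.2.1 u hu), ?_, hfin.2.2.2⟩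
  intro u hu v hv huv
  exact hfin.2.2.1 u hu v hv (hpinj _ (hfin.2.1 u hu) _ (hfin.2.1 v hv) huv)

/-! ### Embedding the core in a window of a median order -/

/-- A set `U` of positions is controlled in the window from `h` to `E` when, for each position `t` of
the window, at most half of the positions from `t` to `E` lie beyond `t` and in `U`. By the median
property each `w ∈ U` then keeps out-neighbours outside `U` as soon as the window is lengthened. -/
def Controlled (h E : ℕ) (U : Finset ℕ) : Prop :=
  ∀ t, h ≤ t → t ≤ E → 2 * #{u ∈ U | t < u} + t ≤ E

theorem Controlled.subset {h E : ℕ} {U V : Finset ℕ} (hV : Controlled h E V) (hUV : U ⊆ V) :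
    Controlled h E U := by
  intro t h1 h2
  have := hV t h1 h2
  have := Finset.card_le_card (Finset.filter_subset_filter (fun u => t < u) hUV)
  omega

theorem controlled_singleton (h : ℕ) : Controlled h h {h} := by
  intro t h1 h2
  obtain rfl : t = h := by omega
  rw [Finset.card_eq_zero.2 (Finset.filter_eq_empty_iff.2 (by simp))]
  omega

theorem Controlled.le {h E : ℕ} {U : Finset ℕ} (hU : Controlled h E U) (hhE : h ≤ E) {u : ℕ}
    (hu : u ∈ U) : u ≤ E := by
  by_contra hcon
  have h1 := hU E hhE le_rfl
  have : 0 < #{u ∈ U | E < u} := Finset.card_pos.2 ⟨u, by simp [hu]; omega⟩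
  omega

theorem Controlled.lt {h E : ℕ} {U : Finset ℕ} (hU : Controlled h E U) (hhE : h < E) {u : ℕ}
    (hu : u ∈ U) : u < E := by
  by_contra hcon
  have h1 := hU (E - 1) (by omega) (by omega)
  have : 0 < #{u ∈ U | E - 1 < u} := Finset.card_pos.2 ⟨u, by simp [hu]; omega⟩
  omega

theorem Controlled.insert_position {h E : ℕ} {U : Finset ℕ} (hU : Controlled h E U) (hhE : h ≤ E) {p : ℕ}
    (hp : p ≤ E + 1) : Controlled h (E + 2) (insert p U) := by
  intro t h1 h2
  rcases le_or_gt t E with h3 | h3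
  · have h4 := hU t h1 h3
    have h5 : #{u ∈ insert p U | t < u} ≤ #{u ∈ U | t < u} + 1 := by
      rw [Finset.filter_insert]
      split_ifs
      · exact Finset.card_insert_le _ _
      · omega
    omega
  · rw [Finset.card_eq_zero.2]
    · omega
    rw [Finset.filter_eq_empty_iff]
    intro u hu
    rcases Finset.mem_insert.1 hu with rfl | hu
    · omega
    · have := hU.le hhE hu
      omega

/-- Controlled sets of each size, in which the first block of a tree is to be placed. -/
theorem exists_controlled_card_eq (h s : ℕ) :
    ∃ P : Finset ℕ, #P = s + 1 ∧ (∀ p ∈ P, h ≤ p) ∧ Controlled h (h + 2 * s) P := by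
  induction s with
  | zero => exact ⟨{h}, by simp, by simp, controlled_singleton h⟩
  | succ s ih =>
    obtain ⟨P, h1, h2, h3⟩ := ih
    rcases Nat.eq_zero_or_pos s with rfl | hs
    · refine ⟨{h, h + 1}, by simp, by simp, ?_⟩
      rw [Finset.pair_comm]
      exact (controlled_singleton h).insert_position le_rfl le_rfl
    refine ⟨insert (h + 2 * s + 1) P, ?_, ?_, ?_⟩
    · rw [Finset.card_insert_of_notMem, h1]
      intro hcon
      have := h3.le (by omega) hcon
      omega
    · intro p hp
      rcases Finset.mem_insert.1 hp with rfl | hp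
      · omega
      · exact h2 p hp
    · exact h3.insert_position (by omega) le_rfl

open Classical in
/-- Lengthening the window by `2 * s` provides `s` new out-neighbours of a used position `w`. -/
theorem Controlled.exists_out_neighbors {R : ℕ → ℕ → Prop} {N : ℕ}
    (hmed : ∀ i j, i < j → j < N → j - i ≤ 2 * #{t ∈ Finset.Ioc i j | R i t})
    {h E : ℕ} {U : Finset ℕ} (hU : Controlled h E U) (hhE : h ≤ E) {w : ℕ} (hw : w ∈ U)
    (hhw : h ≤ w) (s : ℕ) (hs : E + 2 * s ≤ N) :
    ∃ P : Finset ℕ, #P = s ∧ Disjoint U P ∧ (∀ p ∈ P, w < p ∧ R w p) ∧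
      Controlled h (E + 2 * s) (U ∪ P) := by
  induction s with
  | zero => exact ⟨∅, by simp, by simp, by simp, by simpa using hU⟩
  | succ s ih =>
    obtain ⟨P, h1, h2, h3, h4⟩ := ih (by omega)
    set E' := E + 2 * s with hE'
    have hwE : w ≤ E := hU.le hhE hw
    have h5 := h4 w hhw (by omega)
    have h6 := hmed w (E' + 1) (by omega) (by omega)
    have h7 : ∃ p ∈ {t ∈ Finset.Ioc w (E' + 1) | R w t}, p ∉ {u ∈ U ∪ P | w < u} := by
      by_contra! hcon
      have := Finset.card_le_card (show {t ∈ Finset.Ioc w (E' + 1) | R w t} ⊆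
        {u ∈ U ∪ P | w < u} from hcon)
      omega
    obtain ⟨p, hp, hp'⟩ := h7
    simp only [mem_filter, mem_Ioc, mem_union, not_and_or, not_or] at hp hp'
    have hpU : p ∉ U ∧ p ∉ P := hp'.resolve_right (fun h => h hp.1.1)
    refine ⟨insert p P, ?_, ?_, ?_, ?_⟩
    · rw [Finset.card_insert_of_notMem hpU.2, h1]
    · rw [Finset.disjoint_insert_right]
      exact ⟨hpU.1, h2⟩
    · intro q hq
      rcases Finset.mem_insert.1 hq with rfl | hq
      · exact ⟨hp.1.1, hp.2⟩
      · exact h3 q hq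
    · rw [Finset.union_insert]
      exact h4.insert_position (by omega) hp.1.2

/-- Each vertex of a rooted tree lies in a block, a component of the backward arcs; `β` sends a
vertex to the top of its block, which is the root or the head of a forward arc. -/
theorem exists_block_top {C : Type*} (r : C) (π : C → C) (rank : C → ℕ)
    (hπ : ∀ u, u ≠ r → rank (π u) < rank u) (fwd : C → Prop) :
    ∃ β : C → C, (∀ u, u = r ∨ fwd u → β u = u) ∧ (∀ u, ¬ (u = r ∨ fwd u) → β u = β (π u)) ∧
      (∀ u, β u = r ∨ fwd (β u)) ∧ ∀ u, rank (β u) ≤ rank u := by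
  classical
  have hex : ∀ n, ∃ β : C → C, (∀ u, u = r ∨ fwd u → β u = u) ∧
      (∀ u, rank u < n → ¬ (u = r ∨ fwd u) → β u = β (π u)) := by
    intro n
    induction n with
    | zero => exact ⟨id, fun _ _ => rfl, fun u hu => absurd hu (by omega)⟩
    | succ n ih =>
      obtain ⟨β, h1, h2⟩ := ih
      refine ⟨fun u => if u = r ∨ fwd u then u else β (π u), fun u hu => if_pos hu, ?_⟩
      intro u hu hu'
      have hr := hπ u (fun h => hu' (Or.inl h))
      by_cases h : π u = r ∨ fwd (π u)
      · simp only [if_neg hu', if_pos h, h1 _ h]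
      · simp only [if_neg hu', if_neg h]
        exact h2 _ (by omega) h
  choose b hb1 hb2 using hex
  -- The maps obtained for different bounds agree below both bounds.
  have hstab : ∀ k n m u, rank u = k → k < n → k < m → b n u = b m u := by
    intro k
    induction k using Nat.strong_induction_on with
    | _ k ih =>
      intro n m u hk hn hm
      by_cases h : u = r ∨ fwd u
      · rw [hb1 _ _ h, hb1 _ _ h]
      · have hr := hπ u (fun h' => h (Or.inl h'))
        rw [hb2 n u (by omega) h, hb2 m u (by omega) h]
        exact ih _ (by omega) n m (π u) rfl (by omega) (by omega)
  refine ⟨fun u => b (rank u + 1) u, fun u hu => hb1 _ u hu, ?_, ?_⟩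
  · intro u hu
    have hr := hπ u (fun h' => hu (Or.inl h'))
    dsimp only
    rw [hb2 _ u (by omega) hu]
    exact hstab _ _ _ _ rfl (by omega) (by omega)
  · rw [← forall_and]
    have : ∀ k u, rank u = k → (b (k + 1) u = r ∨ fwd (b (k + 1) u)) ∧
        rank (b (k + 1) u) ≤ k := by
      intro k
      induction k using Nat.strong_induction_on with
      | _ k ih =>
        intro u hk
        by_cases h : u = r ∨ fwd u
        · rw [hb1 _ _ h]
          exact ⟨h, by omega⟩
        · have hr := hπ u (fun h' => h (Or.inl h'))
          rw [hb2 _ u (by omega) h, hstab _ (k + 1) (rank (π u) + 1) (π u) rfl (by omega) (by omega)]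
          have := ih (rank (π u)) (by omega) (π u) rfl
          exact ⟨this.1, by omega⟩
    intro u
    exact this _ u rfl

open Classical in
/-- A rooted oriented tree embeds in a window of a median order of length `2 (m + l - b - 1)`, where
`m` is the number of vertices, `l` the number of vertices with no backward child and `b` the number of
blocks. The image is controlled. Blocks are embedded one by one, each of them among out-neighbours of
the image of the parent of its top. -/
theorem exists_controlled_embedding {R : ℕ → ℕ → Prop} {N : ℕ}
    (hR : ∀ a b, a < N → b < N → a ≠ b → R a b ∨ R b a)
    (hmed : ∀ i j, i < j → j < N → j - i ≤ 2 * #{t ∈ Finset.Ioc i j | R i t})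
    {C : Type*} [Fintype C] (r : C) (π : C → C) (rank : C → ℕ)
    (hπ : ∀ u, u ≠ r → rank (π u) < rank u) (fwd : C → Prop) (h E : ℕ) (hhN : h < N) (hEN : E ≤ N)
    (hhE : h + 2 * (Fintype.card C + #{u : C | ∀ c, c ≠ r → ¬ fwd c → π c ≠ u}) =
      E + 2 * #{u : C | u = r ∨ fwd u} + 2) :
    ∃ f : C → ℕ, Function.Injective f ∧ (∀ u, h ≤ f u ∧ f u < N) ∧
      (∀ u, u ≠ r → fwd u → R (f (π u)) (f u)) ∧ (∀ u, u ≠ r → ¬ fwd u → R (f u) (f (π u))) ∧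
      h ≤ E ∧ Controlled h E (univ.image f) := by
  obtain ⟨β, hβ1, hβ2, hβ3, hβ4⟩ := exists_block_top r π rank hπ fwd
  set Z : Finset C := {u : C | u = r ∨ fwd u} with hZ
  set L : Finset C := {u : C | ∀ c, c ≠ r → ¬ fwd c → π c ≠ u} with hL
  set B : C → Finset C := fun z => {u : C | β u = z} with hB
  set l : C → ℕ := fun z => #{u ∈ B z | ∀ c ∈ B z, c ≠ z → π c ≠ u} with hl
  set σ : C → ℕ := fun z => #(B z) + l z - 1 with hσ
  have hmB : ∀ u z, u ∈ B z ↔ β u = z := fun u z => by simp [hB]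
  have hmZ : ∀ u, u ∈ Z ↔ u = r ∨ fwd u := fun u => by simp [hZ]
  have hβZ : ∀ u, β u ∈ Z := fun u => (hmZ _).2 (hβ3 u)
  have hzB : ∀ z ∈ Z, z ∈ B z := fun z hz => (hmB _ _).2 (hβ1 z ((hmZ z).1 hz))
  have hback : ∀ z, ∀ u ∈ B z, u ≠ z → ¬ (u = r ∨ fwd u) := by
    intro z u hu huz hcon
    exact huz ((hβ1 u hcon).symm.trans ((hmB u z).1 hu))
  have hBπ : ∀ z, ∀ u ∈ B z, u ≠ z → π u ∈ B z ∧ rank (π u) < rank u := by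
    intro z u hu huz
    have h1 := hback z u hu huz
    refine ⟨?_, hπ u fun h' => h1 (Or.inl h')⟩
    rw [hmB, ← hβ2 u h1]
    exact (hmB u z).1 hu
  have hleq : ∀ z ∈ Z, l z = #{u ∈ L | β u = z} := by
    intro z hz
    simp only [hl]
    congr 1
    ext u
    simp only [hL, hB, mem_filter, mem_univ, true_and]
    constructor
    · rintro ⟨h1, h2⟩
      refine ⟨?_, h1⟩
      rintro c hcr hcf rfl
      have hcb : ¬ (c = r ∨ fwd c) := by tauto
      refine h2 c ((hβ2 c hcb).trans h1) ?_ rfl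
      rintro rfl
      exact hcb ((hmZ c).1 hz)
    · rintro ⟨h1, h2⟩
      refine ⟨h2, fun c hc hcz => ?_⟩
      have := hback z c ((hmB c z).2 hc) hcz
      exact h1 c (by tauto) (by tauto)
  have hlpos : ∀ z ∈ Z, 1 ≤ l z := by
    intro z hz
    obtain ⟨u, hu, hmax⟩ := Finset.exists_max_image (B z) rank ⟨z, hzB z hz⟩
    refine Finset.card_pos.2 ⟨u, mem_filter.2 ⟨hu, ?_⟩⟩
    rintro c hc hcz rfl
    have h1 := (hBπ z c hc hcz).2
    have h2 := hmax c hc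
    omega
  have hBpos : ∀ z ∈ Z, 1 ≤ #(B z) := fun z hz => Finset.card_pos.2 ⟨z, hzB z hz⟩
  have hσsum : ∑ z ∈ Z, σ z + #Z = Fintype.card C + #L := by
    have h1 : ∑ z ∈ Z, #(B z) = Fintype.card C := by
      rw [← Finset.card_univ]
      exact (Finset.card_eq_sum_card_fiberwise (f := β) (t := Z) (s := univ)
        (fun u _ => hβZ u)).symm
    have h2 : ∑ z ∈ Z, l z = #L := by
      rw [Finset.sum_congr rfl hleq]
      exact (Finset.card_eq_sum_card_fiberwise (f := β) (t := Z) (s := L)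
        (fun u _ => hβZ u)).symm
    rw [← h1, ← h2, Finset.card_eq_sum_ones, ← Finset.sum_add_distrib, ← Finset.sum_add_distrib]
    refine Finset.sum_congr rfl fun z hz => ?_
    have := hlpos z hz
    simp only [hσ]
    omega
  have hrZ : r ∈ Z := (hmZ r).2 (Or.inl rfl)
  have hσpos : ∀ z ∈ Z, 1 ≤ σ z := by
    intro z hz
    have h1 := hlpos z hz
    have h2 := hBpos z hz
    simp only [hσ]
    omega
  have hσle : ∀ D ⊆ Z, ∑ z ∈ D, σ z ≤ ∑ z ∈ Z, σ z :=
    fun D hD => Finset.sum_le_sum_of_subset hD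
  have hE : E = h + 2 * (∑ z ∈ Z, σ z) - 2 := by omega
  have hσZ : 1 ≤ ∑ z ∈ Z, σ z := (hσpos r hrZ).trans (Finset.single_le_sum (by simp) hrZ)
  -- A block `B z` with `l z` leaves needs `σ z` candidate positions, so it lengthens the window by
  -- `2 * σ z`. The set `D` collects the tops of the blocks that are already embedded.
  have key : ∀ j, j + 1 ≤ #Z → ∃ (D : Finset C) (f : C → ℕ), #D = j + 1 ∧ D ⊆ Z ∧ r ∈ D ∧
      (∀ z ∈ D, z ≠ r → β (π z) ∈ D) ∧
      (∀ u v, β u ∈ D → β v ∈ D → f u = f v → u = v) ∧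
      (∀ u, β u ∈ D → h ≤ f u) ∧
      (∀ u, β u ∈ D → u ≠ r → fwd u → R (f (π u)) (f u)) ∧
      (∀ u, β u ∈ D → u ≠ r → ¬ fwd u → R (f u) (f (π u))) ∧
      Controlled h (h + 2 * (∑ z ∈ D, σ z) - 2) (({u : C | β u ∈ D} : Finset C).image f) := by
    intro j
    induction j with
    | zero =>
      intro _
      obtain ⟨P, hP1, hP2, hP3⟩ := exists_controlled_card_eq h (σ r - 1)
      have hσr := hσpos r hrZ
      have hσr' := hσle {r} (by simpa using hrZ)
      rw [Finset.sum_singleton] at hσr'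
      have hPN : ∀ p ∈ P, p < N := by
        intro p hp
        rcases Nat.eq_or_lt_of_le (show h ≤ h + 2 * (σ r - 1) by omega) with heq | hlt
        · have := hP3.le (by omega) hp
          omega
        · have := hP3.lt hlt hp
          omega
      obtain ⟨f, hf1, hf2, hf3⟩ := exists_arborescence_embedding (fun a b => R b a) P
        (fun a ha b hb hab => (hR a b (hPN a ha) (hPN b hb) hab).symm) (B r) r (hzB r hrZ) π rank
        (hBπ r) (by
          have : #(B r) + l r ≤ #P + 1 := by simp only [hσ] at hP1 hσr; omega
          refine le_trans (le_of_eq ?_) this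
          simp only [hl]
          congr!)
      refine ⟨{r}, f, by simp, by simpa using hrZ, by simp, by simp, ?_, ?_, ?_, ?_, ?_⟩
      · intro u v hu hv
        rw [mem_singleton] at hu hv
        exact hf2 u ((hmB _ _).2 hu) v ((hmB _ _).2 hv)
      · intro u hu
        rw [mem_singleton] at hu
        exact hP2 _ (hf1 u ((hmB _ _).2 hu))
      · intro u hu hur hfu
        rw [mem_singleton, hβ1 u (Or.inr hfu)] at hu
        exact absurd hu hur
      · intro u hu hur _
        rw [mem_singleton] at hu
        exact hf3 u ((hmB _ _).2 hu) hur
      · rw [Finset.sum_singleton, show h + 2 * σ r - 2 = h + 2 * (σ r - 1) by omega]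
        refine hP3.subset ?_
        intro p hp
        obtain ⟨u, hu, rfl⟩ := mem_image.1 hp
        simp only [mem_filter, mem_univ, true_and, mem_singleton] at hu
        exact hf1 u ((hmB _ _).2 hu)
    | succ j ih =>
      intro hj
      obtain ⟨D, f, hD1, hD2, hD3, hD4, hf1, hf2, hf3, hf4, hctl⟩ := ih (by omega)
      obtain ⟨z, hz, hmin⟩ := Finset.exists_min_image (Z \ D) rank (by
        rw [Finset.sdiff_nonempty]
        intro hcon
        have := Finset.card_le_card hcon
        omega)
      rw [mem_sdiff] at hz
      have hzr : z ≠ r := fun h' => hz.2 (h' ▸ hD3)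
      have hpz : β (π z) ∈ D := by
        by_contra hcon
        have h1 := hmin (β (π z)) (mem_sdiff.2 ⟨hβZ _, hcon⟩)
        have h2 := hβ4 (π z)
        have h3 := hπ z hzr
        omega
      have hzf : fwd z := ((hmZ z).1 hz.1).resolve_left hzr
      have hDpos : 1 ≤ ∑ z ∈ D, σ z := (hσpos r hrZ).trans (Finset.single_le_sum (by simp) hD3)
      have hins : ∑ y ∈ insert z D, σ y = σ z + ∑ y ∈ D, σ y := Finset.sum_insert hz.2
      have hle := hσle (insert z D) (Finset.insert_subset hz.1 hD2)
      rw [hins] at hle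
      set U := ({u : C | β u ∈ D} : Finset C).image f with hU
      set E₀ := h + 2 * (∑ z ∈ D, σ z) - 2 with hE₀
      have hwU : f (π z) ∈ U := mem_image_of_mem f (by simpa using hpz)
      have hUN : ∀ p ∈ U, h ≤ p := by
        intro p hp
        obtain ⟨u, hu, rfl⟩ := mem_image.1 hp
        exact hf2 u (by simpa using hu)
      obtain ⟨P, hP1, hP2, hP3, hP4⟩ := hctl.exists_out_neighbors hmed (by omega) hwU
        (hf2 _ hpz) (σ z) (by omega)
      have hσz := hσpos z hz.1
      have hPN : ∀ p ∈ P, p < N := by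
        intro p hp
        have := hP4.lt (by omega) (mem_union_right _ hp)
        omega
      have hPh : ∀ p ∈ P, h ≤ p := by
        intro p hp
        have := (hP3 p hp).1
        have := hf2 _ hpz
        omega
      obtain ⟨g, hg1, hg2, hg3⟩ := exists_arborescence_embedding (fun a b => R b a) P
        (fun a ha b hb hab => (hR a b (hPN a ha) (hPN b hb) hab).symm) (B z) z (hzB z hz.1) π rank
        (hBπ z) (by
          have : #(B z) + l z ≤ #P + 1 := by simp only [hσ] at hP1 hσz; omega
          refine le_trans (le_of_eq ?_) this
          simp only [hl]
          congr!)
      have hUP : ∀ u v, β u ∈ D → β v = z → f u ≠ g v := by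
        intro u v hu hv heq
        refine Finset.disjoint_left.1 hP2 (mem_image_of_mem f (by simpa using hu)) ?_
        rw [heq]
        exact hg1 v ((hmB _ _).2 hv)
      have hF1 : ∀ u, β u = z → (if β u = z then g u else f u) = g u := fun u hu => if_pos hu
      have hF2 : ∀ u, β u ∈ D → (if β u = z then g u else f u) = f u :=
        fun u hu => if_neg fun h' => hz.2 (by rwa [h'] at hu)
      have hpD : ∀ u, β u ∈ D → u ≠ r → β (π u) ∈ D := by
        intro u hu hur
        by_cases hfu : fwd u
        · rw [hβ1 u (Or.inr hfu)] at hu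
          exact hD4 u hu hur
        · rwa [← hβ2 u (by tauto)]
      refine ⟨insert z D, fun u => if β u = z then g u else f u, ?_,
        Finset.insert_subset hz.1 hD2, mem_insert_of_mem hD3, ?_, ?_, ?_, ?_, ?_, ?_⟩
      · rw [Finset.card_insert_of_notMem hz.2, hD1]
      · intro y hy hyr
        rcases mem_insert.1 hy with rfl | hy
        · exact mem_insert_of_mem hpz
        · exact mem_insert_of_mem (hD4 y hy hyr)
      · intro u v hu hv huv
        dsimp only at huv
        rw [mem_insert] at hu hv
        rcases hu with hu | hu <;> rcases hv with hv | hv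
        · rw [hF1 u hu, hF1 v hv] at huv
          exact hg2 u ((hmB _ _).2 hu) v ((hmB _ _).2 hv) huv
        · rw [hF1 u hu, hF2 v hv] at huv
          exact absurd huv.symm (hUP v u hv hu)
        · rw [hF2 u hu, hF1 v hv] at huv
          exact absurd huv (hUP u v hu hv)
        · rw [hF2 u hu, hF2 v hv] at huv
          exact hf1 u v hu hv huv
      · intro u hu
        dsimp only
        rcases mem_insert.1 hu with hu | hu
        · rw [hF1 u hu]
          exact hPh _ (hg1 u ((hmB _ _).2 hu))
        · rw [hF2 u hu]
          exact hf2 u hu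
      · intro u hu hur hfu
        dsimp only
        rcases mem_insert.1 hu with hu | hu
        · obtain rfl : u = z := (hβ1 u (Or.inr hfu)).symm.trans hu
          rw [hF1 u hu, hF2 _ hpz]
          exact (hP3 _ (hg1 u ((hmB _ _).2 hu))).2
        · rw [hF2 u hu, hF2 _ (hpD u hu hur)]
          exact hf3 u hu hur hfu
      · intro u hu hur hfu
        dsimp only
        rcases mem_insert.1 hu with hu | hu
        · have hπu : β (π u) = z := by rw [← hβ2 u (by tauto), hu]
          rw [hF1 u hu, hF1 _ hπu]
          refine hg3 u ((hmB _ _).2 hu) ?_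
          rintro rfl
          exact hfu hzf
        · rw [hF2 u hu, hF2 _ (hpD u hu hur)]
          exact hf4 u hu hur hfu
      · rw [hins, show h + 2 * (σ z + ∑ y ∈ D, σ y) - 2 = E₀ + 2 * σ z by omega]
        refine hP4.subset ?_
        intro p hp
        obtain ⟨u, hu, rfl⟩ := mem_image.1 hp
        simp only [mem_filter, mem_univ, true_and, mem_insert] at hu
        rcases hu with hu | hu
        · rw [hF1 u hu]
          exact mem_union_right _ (hg1 u ((hmB _ _).2 hu))
        · rw [hF2 u hu]
          exact mem_union_left _ (mem_image_of_mem f (by simpa using hu))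
  have hZpos : 0 < #Z := Finset.card_pos.2 ⟨r, hrZ⟩
  obtain ⟨D, f, hD1, hD2, -, -, hf1, hf2, hf3, hf4, hctl⟩ := key (#Z - 1) (by omega)
  obtain rfl : Z = D := (Finset.eq_of_subset_of_card_le hD2 (by omega)).symm
  have himg : ({u : C | β u ∈ Z} : Finset C) = univ := by
    ext u
    simpa using hβZ u
  rw [himg, ← hE] at hctl
  refine ⟨f, fun u v => hf1 u v (hβZ u) (hβZ v), fun u => ⟨hf2 u (hβZ u), ?_⟩,
    fun u => hf3 u (hβZ u), fun u => hf4 u (hβZ u), by omega, hctl⟩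
  rcases Nat.eq_or_lt_of_le (show h ≤ E by omega) with heq | hlt
  · have := hctl.le (by omega) (mem_image_of_mem f (mem_univ u))
    omega
  · have := hctl.lt hlt (mem_image_of_mem f (mem_univ u))
    omega

/-! ### Placing the leaves -/

open Classical in
/-- The out-leaves and in-leaves of an embedded rooted tree can be placed at free positions. This is
Hall's theorem: a set of leaves with parents `X` of out-leaves and `Y` of in-leaves is tested on the
out-neighbours after the last vertex of `X` and the in-neighbours before the first vertex of `Y`. The
critical case has all of `X` before all of `Y`: then the common neighbours lie between them, where
`X` and `Y` themselves take no room, while every childless vertex outside `X ∪ Y` has a leaf that is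
not in the set. -/
theorem exists_leaf_positions {R : ℕ → ℕ → Prop} {N : ℕ}
    (hR : ∀ a b, a < N → b < N → a ≠ b → R a b ∨ R b a)
    (hmed : ∀ i j, i < j → j < N → j - i ≤ 2 * #{t ∈ Finset.Ioc i j | R i t})
    (hmed' : ∀ i j, i < j → j < N → j - i ≤ 2 * #{t ∈ Finset.Ico i j | R t j})
    {C L : Type*} [Fintype C] [Fintype L] (f : C → ℕ) (hf : Function.Injective f) (h E : ℕ)
    (hhE : h ≤ E) (hfN : ∀ u, h ≤ f u ∧ f u < N) (hctl : Controlled h E (univ.image f))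
    (par : L → C) (out : L → Prop) (K : Finset C) (hK : ∀ u ∈ K, ∃ x, par x = u)
    (hE : E + 2 * #{x : L | out x} = N)
    (hh : 2 * #{x : L | ¬ out x} + 2 * Fintype.card C ≤ h + 1 + #K) :
    ∃ g : L → ℕ, Function.Injective g ∧ (∀ x, g x < N) ∧ (∀ u x, f u ≠ g x) ∧
      (∀ x, out x → R (f (par x)) (g x)) ∧ (∀ x, ¬ out x → R (g x) (f (par x))) := by
  set S := univ.image f with hS
  have hcS : #S = Fintype.card C := by rw [hS, Finset.card_image_of_injective _ hf, card_univ]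
  have hKC : #K ≤ Fintype.card C := Finset.card_le_univ K
  have hL : #{x : L | out x} + #{x : L | ¬ out x} = Fintype.card L := by
    rw [← card_univ]
    exact card_filter_add_card_filter_of_iff_not _ _ _ fun _ _ => Iff.rfl
  have hfS : ∀ u, f u ∈ S := fun u => mem_image_of_mem f (mem_univ u)
  set A : ℕ → Finset ℕ := fun i => {q ∈ Finset.Ioc i (N - 1) | R i q} with hA
  set B : ℕ → Finset ℕ := fun j => {q ∈ Finset.Ico 0 j | R q j} with hB
  have hAcard : ∀ i, i < N → N - 1 - i ≤ 2 * #(A i) := by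
    intro i hi
    rcases Nat.eq_or_lt_of_le (show i ≤ N - 1 by omega) with heq | hlt
    · omega
    · exact hmed i (N - 1) hlt (by omega)
  have hBcard : ∀ j, j < N → j ≤ 2 * #(B j) := by
    intro j hj
    rcases Nat.eq_zero_or_pos j with rfl | hpos
    · omega
    · exact hmed' 0 j hpos hj
  -- The bounds on the neighbours that remain free.
  have hAfree : ∀ u, N ≤ E + 1 + 2 * #(A (f u) \ S) := by
    intro u
    have h1 := hctl (f u) (hfN u).1 (hctl.le hhE (hfS u))
    have h2 := hAcard (f u) (hfN u).2
    have h3 : #(A (f u)) ≤ #(A (f u) \ S) + #{v ∈ S | f u < v} := by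
      refine le_trans (Finset.card_le_card ?_) (Finset.card_union_le _ _)
      intro q hq
      have hq' := (mem_filter.1 hq).1
      simp only [mem_union, mem_sdiff, mem_filter, mem_Ioc] at hq' ⊢
      tauto
    have := hctl.le hhE (hfS u)
    omega
  have hBfree : ∀ u, h + 1 ≤ Fintype.card C + 2 * #(B (f u) \ S) := by
    intro u
    have h2 := hBcard (f u) (hfN u).2
    have h3 : #(B (f u)) ≤ #(B (f u) \ S) + #{v ∈ S | v < f u} := by
      refine le_trans (Finset.card_le_card ?_) (Finset.card_union_le _ _)
      intro q hq
      have hq' := (mem_filter.1 hq).1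
      simp only [mem_union, mem_sdiff, mem_filter, mem_Ico] at hq' ⊢
      tauto
    have h4 : #{v ∈ S | v < f u} < #S :=
      Finset.card_lt_card (Finset.filter_ssubset.2 ⟨f u, hfS u, by omega⟩)
    have h5 : #{v ∈ S | v < f u} ≤ #(Finset.Ico h (f u)) := by
      refine Finset.card_le_card fun v hv => ?_
      obtain ⟨hv1, hv2⟩ := mem_filter.1 hv
      obtain ⟨w, -, rfl⟩ := mem_image.1 hv1
      exact mem_Ico.2 ⟨(hfN w).1, hv2⟩
    rw [Nat.card_Ico] at h5
    have := (hfN u).1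
    omega
  set t : L → Finset ℕ := fun x => {q ∈ range N | q ∉ S ∧
    ((out x → R (f (par x)) q) ∧ (¬ out x → R q (f (par x))))} with ht
  have htA : ∀ x, out x → A (f (par x)) \ S ⊆ t x := by
    intro x hx q hq
    simp only [hA, ht, mem_sdiff, mem_filter, mem_Ioc, mem_range] at hq ⊢
    exact ⟨by omega, hq.2, fun _ => hq.1.2, fun hx' => absurd hx hx'⟩
  have htB : ∀ x, ¬ out x → B (f (par x)) \ S ⊆ t x := by
    intro x hx q hq
    simp only [hB, ht, mem_sdiff, mem_filter, mem_Ico, mem_range] at hq ⊢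
    have := (hfN (par x)).2
    exact ⟨by omega, hq.2, fun hx' => absurd hx' hx, fun _ => hq.1.2⟩
  have hall : ∀ s : Finset L, #s ≤ #(s.biUnion t) := by
    intro s
    have hsplit : #{x ∈ s | out x} + #{x ∈ s | ¬ out x} = #s :=
      card_filter_add_card_filter_of_iff_not _ _ _ fun _ _ => Iff.rfl
    have hso : #{x ∈ s | out x} ≤ #{x : L | out x} :=
      Finset.card_le_card (Finset.filter_subset_filter _ (subset_univ s))
    have hsi : #{x ∈ s | ¬ out x} ≤ #{x : L | ¬ out x} :=
      Finset.card_le_card (Finset.filter_subset_filter _ (subset_univ s))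
    rcases Finset.eq_empty_or_nonempty {x ∈ s | out x} with hs1 | hs1
    · rcases Finset.eq_empty_or_nonempty s with rfl | ⟨x, hx⟩
      · simp
      have hxo : ¬ out x := fun hxo => by
        have : x ∈ {x ∈ s | out x} := mem_filter.2 ⟨hx, hxo⟩
        simp [hs1] at this
      rw [hs1, Finset.card_empty] at hsplit
      have h1 := hBfree (par x)
      have h2 := Finset.card_le_card ((htB x hxo).trans (Finset.subset_biUnion_of_mem t hx))
      omega
    rcases Finset.eq_empty_or_nonempty {x ∈ s | ¬ out x} with hs2 | hs2
    · obtain ⟨x, hx⟩ := hs1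
      obtain ⟨hx, hxo⟩ := mem_filter.1 hx
      rw [hs2, Finset.card_empty] at hsplit
      have h1 := hAfree (par x)
      have h2 := Finset.card_le_card ((htA x hxo).trans (Finset.subset_biUnion_of_mem t hx))
      omega
    obtain ⟨x, hx, hxmax⟩ := Finset.exists_max_image _ (fun x => f (par x)) hs1
    obtain ⟨y, hy, hymin⟩ := Finset.exists_min_image _ (fun x => f (par x)) hs2
    obtain ⟨hxs, hxo⟩ := mem_filter.1 hx
    obtain ⟨hys, hyo⟩ := mem_filter.1 hy
    have hAt := (htA x hxo).trans (Finset.subset_biUnion_of_mem t hxs)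
    have hBt := (htB y hyo).trans (Finset.subset_biUnion_of_mem t hys)
    have hABt := Finset.card_le_card (Finset.union_subset hAt hBt)
    -- `par x` is the last vertex of `X`, and `par y` the first vertex of `Y`.
    rcases lt_trichotomy (f (par x)) (f (par y)) with hlt | heq | hgt
    · have hEy : ∀ u, f u < E := by
        intro u
        have h1 := hctl.le hhE (hfS (par y))
        have h2 := (hfN (par x)).1
        exact hctl.lt (by omega) (hfS u)
      have h1 := hAcard _ (hfN (par x)).2
      have h2 := hBcard _ (hfN (par y)).2
      have h3 := Finset.card_union_add_card_inter (A (f (par x))) (B (f (par y)))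
      have h4 : #(A (f (par x)) ∩ B (f (par y))) ≤ f (par y) - f (par x) - 1 := by
        rw [← Nat.card_Ioo]
        refine Finset.card_le_card fun q hq => ?_
        simp only [hA, hB, mem_inter, mem_filter, mem_Ioc, mem_Ico, mem_Ioo] at hq ⊢
        omega
      have h5 : #(A (f (par x)) ∪ B (f (par y))) ≤
          #(A (f (par x)) \ S ∪ B (f (par y)) \ S) + #S := by
        rw [← Finset.union_sdiff_distrib]
        exact Finset.card_le_card_sdiff_add_card
      set X := ({x ∈ s | out x} : Finset L).image par with hX
      set Y := ({x ∈ s | ¬ out x} : Finset L).image par with hY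
      have hXc : #X ≤ f (par x) + 1 - h := by
        rw [← Nat.card_Icc, ← Finset.card_image_of_injective X hf]
        refine Finset.card_le_card fun q hq => ?_
        simp only [hX, mem_image] at hq
        obtain ⟨_, ⟨x', hx', rfl⟩, rfl⟩ := hq
        exact mem_Icc.2 ⟨(hfN _).1, hxmax x' hx'⟩
      have hYc : #Y ≤ E - f (par y) := by
        rw [← Nat.card_Ico, ← Finset.card_image_of_injective Y hf]
        refine Finset.card_le_card fun q hq => ?_
        simp only [hY, mem_image] at hq
        obtain ⟨_, ⟨x', hx', rfl⟩, rfl⟩ := hq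
        exact mem_Ico.2 ⟨hymin x' hx', hEy _⟩
      have hXY := Finset.card_union_le X Y
      have hK' : #(K \ (X ∪ Y)) ≤ #(univ \ s) := by
        have : Nonempty L := ⟨x⟩
        choose! c hc using hK
        refine Finset.card_le_card_of_injOn c ?_ ?_
        · intro u hu
          have hu' := mem_sdiff.1 hu
          have hcu := hc u hu'.1
          simp only [coe_sdiff, coe_univ, Set.mem_sdiff, Set.mem_univ, true_and, mem_coe]
          intro hcs
          refine hu'.2 (mem_union.2 ?_)
          by_cases hco : out (c u)
          · exact Or.inl (mem_image.2 ⟨c u, mem_filter.2 ⟨hcs, hco⟩, hcu⟩)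
          · exact Or.inr (mem_image.2 ⟨c u, mem_filter.2 ⟨hcs, hco⟩, hcu⟩)
        · intro u hu v hv huv
          rw [← hc u (mem_sdiff.1 hu).1, ← hc v (mem_sdiff.1 hv).1, huv]
      have hK'' : #K ≤ #(K \ (X ∪ Y)) + #(X ∪ Y) := Finset.card_le_card_sdiff_add_card
      rw [Finset.card_sdiff_of_subset (subset_univ s), card_univ] at hK'
      have h6 : #s ≤ Fintype.card L := Finset.card_le_univ s
      have h7 := (hfN (par x)).1
      have h8 := hEy (par y)
      omega
    -- If a vertex is in both `X` and `Y`, each free position is a neighbour of it.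
    · have h1 : range N \ S ⊆ s.biUnion t := by
        intro q hq
        rw [mem_sdiff, mem_range] at hq
        have hne : f (par x) ≠ q := fun hcon => hq.2 (hcon ▸ hfS _)
        rcases hR _ _ (hfN (par x)).2 hq.1 hne with h2 | h2
        · refine mem_biUnion.2 ⟨x, hxs, ?_⟩
          simp only [ht, mem_filter, mem_range]
          exact ⟨hq.1, hq.2, fun _ => h2, fun h' => absurd hxo h'⟩
        · refine mem_biUnion.2 ⟨y, hys, ?_⟩
          simp only [ht, mem_filter, mem_range]
          exact ⟨hq.1, hq.2, fun h' => absurd h' hyo, fun _ => heq ▸ h2⟩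
      have h2 := Finset.card_le_card h1
      have h3 : #(range N) ≤ #(range N \ S) + #S := Finset.card_le_card_sdiff_add_card
      rw [card_range] at h3
      have h4 : 0 < #{x ∈ s | out x} := Finset.card_pos.2 hs1
      omega
    · have hdis : Disjoint (A (f (par x)) \ S) (B (f (par y)) \ S) := by
        rw [Finset.disjoint_left]
        intro q hq hq'
        simp only [hA, hB, mem_sdiff, mem_filter, mem_Ioc, mem_Ico] at hq hq'
        omega
      rw [Finset.card_union_of_disjoint hdis] at hABt
      have h1 := hAfree (par x)
      have h2 := hBfree (par y)
      omega
  obtain ⟨g, hg, hgt⟩ := (Finset.all_card_le_biUnion_card_iff_exists_injective t).1 hall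
  simp only [ht, mem_filter, mem_range] at hgt
  exact ⟨g, hg, fun x => (hgt x).1, fun u x hux => (hgt x).2.1 (hux ▸ hfS u),
    fun x => (hgt x).2.2.1, fun x => (hgt x).2.2.2⟩

open Classical in
/-- There are at least as many vertices without backward child as blocks: the other vertices are
parents of vertices that are not tops. -/
theorem card_tops_le {C : Type*} [Fintype C] (r : C) (π : C → C) (fwd : C → Prop) :
    #{u : C | u = r ∨ fwd u} ≤ #{u : C | ∀ c, c ≠ r → ¬ fwd c → π c ≠ u} := by
  have h1 : #{u : C | u = r ∨ fwd u} + #{u : C | ¬ (u = r ∨ fwd u)} = #(univ : Finset C) :=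
    card_filter_add_card_filter_of_iff_not _ _ _ fun _ _ => Iff.rfl
  have h2 : #{u : C | ∀ c, c ≠ r → ¬ fwd c → π c ≠ u} +
      #{u : C | ¬ ∀ c, c ≠ r → ¬ fwd c → π c ≠ u} = #(univ : Finset C) :=
    card_filter_add_card_filter_of_iff_not _ _ _ fun _ _ => Iff.rfl
  have h3 : #{u : C | ¬ ∀ c, c ≠ r → ¬ fwd c → π c ≠ u} ≤ #{u : C | ¬ (u = r ∨ fwd u)} := by
    refine le_trans (Finset.card_le_card ?_)
      (Finset.card_image_le (s := {u : C | ¬ (u = r ∨ fwd u)}) (f := π))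
    intro u hu
    simp only [mem_filter, mem_univ, true_and] at hu
    push Not at hu
    obtain ⟨c, hcr, hcf, rfl⟩ := hu
    exact mem_image_of_mem π (by simp [hcr, hcf])
  omega

open Classical in
/-- The embedding of a rooted tree with its leaves, when the tree has so few vertices without backward
child that it embeds in a short window. -/
theorem exists_embedding_of_few_backward_ends {W : Type*} [Fintype W] (T : W → W → Prop)
    (hT : ∀ a b, a ≠ b → T a b ∨ T b a) {C L : Type*} [Fintype C] [Fintype L]
    (r : C) (π : C → C) (rank : C → ℕ) (hπ : ∀ u, u ≠ r → rank (π u) < rank u) (fwd : C → Prop)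
    (par : L → C) (out : L → Prop) (hchild : ∀ u, (∀ c, c ≠ r → π c ≠ u) → ∃ x, par x = u)
    (hdir : 2 * #{u : C | ∀ c, c ≠ r → ¬ fwd c → π c ≠ u} + 1 ≤
      #{u : C | ∀ c, c ≠ r → π c ≠ u} + 2 * #{u : C | u = r ∨ fwd u})
    (hout : 2 ≤ Fintype.card C ∨ ∃ x, out x)
    (hN : 4 * Fintype.card C + 2 * Fintype.card L ≤ Fintype.card W + 4) :
    ∃ (f : C → W) (g : L → W), Function.Injective f ∧ Function.Injective g ∧ (∀ u x, f u ≠ g x) ∧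
      (∀ u, u ≠ r → fwd u → T (f (π u)) (f u)) ∧ (∀ u, u ≠ r → ¬ fwd u → T (f u) (f (π u))) ∧
      (∀ x, out x → T (f (par x)) (g x)) ∧ (∀ x, ¬ out x → T (g x) (f (par x))) := by
  have hL : #{x : L | out x} + #{x : L | ¬ out x} = Fintype.card L := by
    rw [← card_univ]
    exact card_filter_add_card_filter_of_iff_not _ _ _ fun _ _ => Iff.rfl
  have hC : 1 ≤ Fintype.card C := Fintype.card_pos_iff.2 ⟨r⟩
  have hKC := Finset.card_le_univ ({u : C | ∀ c, c ≠ r → π c ≠ u} : Finset C)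
  have htops := card_tops_le r π fwd
  have hout' : 2 ≤ Fintype.card C ∨ 1 ≤ #{x : L | out x} := by
    refine hout.imp_right ?_
    rintro ⟨x, hx⟩
    exact Finset.card_pos.2 ⟨x, by simpa using hx⟩
  have : Nonempty W := Fintype.card_pos_iff.1 (by omega)
  obtain ⟨p, -, hp, hmed, hmed'⟩ := exists_median_order T univ (fun a _ b _ => hT a b)
  rw [card_univ] at hp hmed hmed'
  set N := Fintype.card W with hNdef
  set m := Fintype.card C with hm
  set lB := #{u : C | ∀ c, c ≠ r → ¬ fwd c → π c ≠ u} with hlB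
  set b := #{u : C | u = r ∨ fwd u} with hb
  have hR : ∀ i j, i < N → j < N → i ≠ j → T (p i) (p j) ∨ T (p j) (p i) :=
    fun i j hi hj hij => hT _ _ fun h => hij (hp i hi j hj h)
  obtain ⟨f, hf1, hf2, hf3, hf4, hhE, hctl⟩ := exists_controlled_embedding
    (R := fun i j => T (p i) (p j)) hR hmed r π rank hπ fwd
    (N - 2 * #{x : L | out x} - (2 * (m + lB - b) - 2)) (N - 2 * #{x : L | out x})
    (by omega) (by omega) (by omega)
  obtain ⟨g, hg1, hg2, hg3, hg4, hg5⟩ := exists_leaf_positions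
    (R := fun i j => T (p i) (p j)) hR hmed hmed' f hf1 _ _ hhE hf2 hctl par out
    {u : C | ∀ c, c ≠ r → π c ≠ u} (fun u hu => hchild u (mem_filter.1 hu).2) (by omega) (by omega)
  exact ⟨fun u => p (f u), fun x => p (g x),
    fun u v huv => hf1 (hp _ (hf2 u).2 _ (hf2 v).2 huv),
    fun x y hxy => hg1 (hp _ (hg2 x) _ (hg2 y) hxy),
    fun u x hux => hg3 u x (hp _ (hf2 u).2 _ (hg2 x) hux), hf3, hf4, hg4, hg5⟩

open Classical in
/-- A rooted tree with `m` vertices, to which `k` leaves are attached so that every childless vertex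
gets at least one, embeds in every tournament with at least `4 (m - 1) + 2 k` vertices. A vertex with
children has a forward or a backward child; so the previous lemma applies to the tree or, after all
arcs of the tree and of the tournament are reversed, to the reversed tree. -/
theorem exists_rooted_embedding {W : Type*} [Fintype W] (T : W → W → Prop)
    (hT : ∀ a b, a ≠ b → T a b ∨ T b a) {C L : Type*} [Fintype C] [Fintype L]
    (r : C) (π : C → C) (rank : C → ℕ) (hπ : ∀ u, u ≠ r → rank (π u) < rank u) (fwd : C → Prop)
    (par : L → C) (out : L → Prop) (hchild : ∀ u, (∀ c, c ≠ r → π c ≠ u) → ∃ x, par x = u)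
    (hN : 4 * Fintype.card C + 2 * Fintype.card L ≤ Fintype.card W + 4) :
    ∃ (f : C → W) (g : L → W), Function.Injective f ∧ Function.Injective g ∧ (∀ u x, f u ≠ g x) ∧
      (∀ u, u ≠ r → fwd u → T (f (π u)) (f u)) ∧ (∀ u, u ≠ r → ¬ fwd u → T (f u) (f (π u))) ∧
      (∀ x, out x → T (f (par x)) (g x)) ∧ (∀ x, ¬ out x → T (g x) (f (par x))) := by
  obtain ⟨bwd, hbwd⟩ : ∃ bwd : C → Prop, ∀ u, bwd u ↔ ¬ fwd u := ⟨_, fun _ => Iff.rfl⟩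
  obtain ⟨inn, hinn⟩ : ∃ inn : L → Prop, ∀ x, inn x ↔ ¬ out x := ⟨_, fun _ => Iff.rfl⟩
  set lB := #{u : C | ∀ c, c ≠ r → ¬ fwd c → π c ≠ u} with hlB
  set lF := #{u : C | ∀ c, c ≠ r → ¬ bwd c → π c ≠ u} with hlF
  set b := #{u : C | u = r ∨ fwd u} with hb
  set b' := #{u : C | u = r ∨ bwd u} with hb'
  set c₀ := #{u : C | ∀ c, c ≠ r → π c ≠ u} with hc₀
  have hsum : lB + lF ≤ Fintype.card C + c₀ := by
    rw [hlB, hlF, hc₀, ← card_univ, ← Finset.card_union_add_card_inter]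
    refine Nat.add_le_add (Finset.card_le_card (subset_univ _)) (Finset.card_le_card ?_)
    intro u hu
    simp only [mem_inter, mem_filter, mem_univ, true_and] at hu ⊢
    intro c hc
    by_cases hcf : fwd c
    · exact hu.2 c hc (by simpa [hbwd] using hcf)
    · exact hu.1 c hc hcf
  have hbsum : b + b' = Fintype.card C + 1 := by
    rw [hb, hb', ← card_univ, ← Finset.card_union_add_card_inter]
    congr 1
    · congr 1
      ext u
      simp only [mem_union, mem_filter, mem_univ, true_and, iff_true, hbwd]
      tauto
    · rw [Finset.card_eq_one]
      refine ⟨r, ?_⟩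
      ext u
      simp only [mem_inter, mem_filter, mem_univ, true_and, mem_singleton, hbwd]
      tauto
  have htB : b ≤ lB := card_tops_le r π fwd
  have htF : b' ≤ lF := card_tops_le r π bwd
  have hC : 1 ≤ Fintype.card C := Fintype.card_pos_iff.2 ⟨r⟩
  have hK : c₀ ≤ Fintype.card C := Finset.card_le_univ _
  have hbC : b ≤ Fintype.card C := Finset.card_le_univ _
  by_cases hdir : 2 * lB + 1 ≤ c₀ + 2 * b ∧ (2 ≤ Fintype.card C ∨ ∃ x, out x)
  · exact exists_embedding_of_few_backward_ends T hT r π rank hπ fwd par out hchild hdir.1 hdir.2 hN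
  have hout : 2 ≤ Fintype.card C ∨ ∃ x, inn x := by
    by_contra! hcon
    obtain ⟨x, -⟩ := hchild r fun c hcr =>
      absurd (Fintype.card_le_one_iff.1 (by omega : Fintype.card C ≤ 1) c r) hcr
    have hcard : Fintype.card C = 1 := by omega
    have hlBC : lB ≤ Fintype.card C := Finset.card_le_univ _
    have hb1 : 1 ≤ b := Finset.card_pos.2 ⟨r, by simp⟩
    have hc₀1 : 1 ≤ c₀ := by omega
    exact hdir ⟨by omega, Or.inr ⟨x, by simpa [hinn] using hcon.2 x⟩⟩
  have hdir' : 2 * lF + 1 ≤ c₀ + 2 * b' := by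
    by_contra hcon
    have hm : ¬ 2 ≤ Fintype.card C := fun h => hdir ⟨by omega, Or.inl h⟩
    have hlFC : lF ≤ Fintype.card C := Finset.card_le_univ _
    have hb1 : 1 ≤ b' := Finset.card_pos.2 ⟨r, by simp⟩
    have hb2 : 1 ≤ b := Finset.card_pos.2 ⟨r, by simp⟩
    have hc₀1 : 1 ≤ c₀ := Finset.card_pos.2 ⟨r, by
      simp only [mem_filter, mem_univ, true_and]
      intro c hcr
      exact absurd (Fintype.card_le_one_iff.1 (by omega : Fintype.card C ≤ 1) c r) hcr⟩
    omega
  obtain ⟨f, g, h1, h2, h3, h4, h5, h6, h7⟩ := exists_embedding_of_few_backward_ends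
    (fun a c => T c a) (fun a c hac => (hT a c hac).symm) r π rank hπ bwd par inn hchild hdir' hout hN
  exact ⟨f, g, h1, h2, h3, fun u hu hfu => h5 u hu (by simpa [hbwd] using hfu),
    fun u hu hfu => h4 u hu ((hbwd u).2 hfu), fun x hx => h7 x (by simpa [hinn] using hx),
    fun x hx => h6 x ((hinn x).2 hx)⟩

/-! ### Rooting an oriented tree -/

open Classical in
/-- A tree rooted at `r`: each other vertex has a parent, which is closer to `r`, and every edge joins
a vertex to its parent. -/
theorem SimpleGraph.IsTree.exists_parent {V : Type*} [Fintype V] {G : SimpleGraph V}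
    (hG : G.IsTree) (r : V) :
    ∃ π : V → V, (∀ u, u ≠ r → G.Adj (π u) u ∧ G.dist (π u) r < G.dist u r) ∧
      ∀ u v, G.Adj u v → (u ≠ r ∧ π u = v) ∨ (v ≠ r ∧ π v = u) := by
  have hex : ∀ u, u ≠ r → ∃ v, G.Adj v u ∧ G.dist v r < G.dist u r := by
    intro u hur
    obtain ⟨p, hp⟩ := hG.connected.exists_walk_length_eq_dist u r
    cases p with
    | nil => exact absurd rfl hur
    | cons hadj q =>
      refine ⟨_, hadj.symm, ?_⟩
      have := SimpleGraph.dist_le q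
      rw [SimpleGraph.Walk.length_cons] at hp
      omega
  have : Nonempty V := ⟨r⟩
  choose! π hπ using hex
  refine ⟨π, hπ, ?_⟩
  -- The edges from the vertices to their parents are as many as the edges of the tree.
  have hinj : Set.InjOn (fun u => s(u, π u)) (({u : V | u ≠ r} : Finset V) : Set V) := by
    intro u hu v hv huv
    simp only [coe_filter, mem_univ, true_and, Set.mem_ofPred_eq] at hu hv
    rcases Sym2.eq_iff.1 huv with h | h
    · exact h.1
    · have h1 := (hπ u hu).2
      have h2 := (hπ v hv).2
      rw [h.2] at h1
      rw [← h.1] at h2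
      omega
  have himg : ({u : V | u ≠ r} : Finset V).image (fun u => s(u, π u)) = G.edgeFinset := by
    refine Finset.eq_of_subset_of_card_le ?_ ?_
    · intro e he
      obtain ⟨u, hu, rfl⟩ := mem_image.1 he
      simp only [mem_filter, mem_univ, true_and] at hu
      simpa using (hπ u hu).1.symm
    · rw [Finset.card_image_of_injOn hinj]
      have h1 := hG.card_edgeFinset
      have h2 : ({u : V | u ≠ r} : Finset V) = univ.erase r := by
        ext u
        simp
      rw [h2, Finset.card_erase_of_mem (mem_univ r), card_univ]
      omega
  intro u v huv
  have : s(u, v) ∈ G.edgeFinset := by simpa using huv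
  rw [← himg] at this
  obtain ⟨w, hw, hwe⟩ := mem_image.1 this
  simp only [mem_filter, mem_univ, true_and] at hw
  rcases Sym2.eq_iff.1 hwe with ⟨rfl, h⟩ | ⟨rfl, h⟩
  · exact Or.inl ⟨hw, h⟩
  · exact Or.inr ⟨hw, h⟩

/-- A tree with at least three vertices has a vertex with two neighbours. -/
theorem SimpleGraph.IsTree.exists_not_subsingleton {V : Type*} [Fintype V] {G : SimpleGraph V}
    (hG : G.IsTree) (h3 : 3 ≤ Fintype.card V) : ∃ v, ¬ {w | G.Adj v w}.Subsingleton := by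
  obtain ⟨a, b, c, hab, hac, hbc⟩ := Fintype.two_lt_card_iff.1 h3
  obtain ⟨π, hπ, -⟩ := hG.exists_parent a
  by_cases hu : ∃ u, u ≠ a ∧ π u ≠ a
  · obtain ⟨u, hua, hpa⟩ := hu
    refine ⟨π u, fun hs => ?_⟩
    have h1 := hs (hπ u hua).1 (hπ _ hpa).1.symm
    have h2 := (hπ u hua).2
    have h3 := (hπ _ hpa).2
    rw [← h1] at h3
    omega
  · push Not at hu
    refine ⟨a, fun hs => hbc (hs ?_ ?_)⟩
    · have := (hπ b hab.symm).1
      rwa [hu b hab.symm] at this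
    · have := (hπ c hac.symm).1
      rwa [hu c hac.symm] at this

theorem mainTheorem3 {V : Type u} [Fintype V] (A : Digraph V) (n k : ℕ)
    (hA : A.IsOrientedTree) (hn : Fintype.card V = n) (hn3 : 3 ≤ n)
    (hk : A.leaves.ncard = k) :
    Digraph.IsUnavoidable.{u, v} A ⌈(9 / 2 * n - 5 / 2 * k - 9 / 2 : ℚ)⌉₊ := by
  classical
  intro W _ T hT hW
  obtain ⟨G, hG, hAG, hGA⟩ := hA
  have hTtot : ∀ a b, a ≠ b → T.Adj a b ∨ T.Adj b a := fun a b hab => (hT.2 a b).1 hab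
  have hleaf : ∀ x, x ∈ A.leaves ↔ {y | G.Adj x y}.Subsingleton := by
    intro x
    simp only [Digraph.leaves, hGA]
    rfl
  obtain ⟨r, hr⟩ := hG.exists_not_subsingleton (by omega)
  rw [← hleaf] at hr
  obtain ⟨π, hπ, hedge⟩ := hG.exists_parent r
  -- The parent of a vertex is never a leaf, since the root is not one.
  have hπleaf : ∀ u, u ≠ r → π u ∉ A.leaves := by
    intro u hur hl
    have hpr : π u ≠ r := fun h => hr (h ▸ hl)
    have h1 := (hleaf _).1 hl (hπ u hur).1 (hπ _ hpr).1.symm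
    have h2 := (hπ u hur).2
    have h3 := (hπ _ hpr).2
    rw [← h1] at h3
    omega
  have hne : ∀ x : {x // x ∈ A.leaves}, (x : V) ≠ r := fun x h => hr (h ▸ x.2)
  have hpC : ∀ u : {x // x ∉ A.leaves}, ∃ w : {x // x ∉ A.leaves}, (u : V) ≠ r → (w : V) = π u := by
    intro u
    by_cases hu : (u : V) = r
    · exact ⟨u, fun h => absurd hu h⟩
    · exact ⟨⟨π u, hπleaf _ hu⟩, fun _ => rfl⟩
  choose pC hpC using hpC
  have hpar : ∀ x : {x // x ∈ A.leaves}, ∃ w : {x // x ∉ A.leaves}, (w : V) = π x :=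
    fun x => ⟨⟨π x, hπleaf _ (hne x)⟩, rfl⟩
  choose par hpar using hpar
  have hner : ∀ u : {x // x ∉ A.leaves}, u ≠ ⟨r, hr⟩ → (u : V) ≠ r :=
    fun u hu h => hu (Subtype.ext h)
  -- A vertex that is not a leaf has a child, possibly a leaf.
  have hch : ∀ u : {x // x ∉ A.leaves}, ∃ c, c ≠ r ∧ π c = u := by
    intro u
    by_contra! hcon
    refine u.2 ((hleaf _).2 fun a ha b hb => ?_)
    rcases hedge _ _ ha with h1 | h1
    · rcases hedge _ _ hb with h2 | h2
      · exact h1.2.symm.trans h2.2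
      · exact absurd h2.2 (hcon b h2.1)
    · exact absurd h1.2 (hcon a h1.1)
  have hcardL : Fintype.card {x // x ∈ A.leaves} = k := by
    rw [← hk, ← Nat.card_eq_fintype_card]
    rfl
  have hcard : Fintype.card {x // x ∉ A.leaves} + k = n := by
    have := Fintype.card_subtype_compl (fun x => x ∈ A.leaves)
    have h2 := Fintype.card_subtype_le (fun x => x ∈ A.leaves)
    omega
  have hC : 1 ≤ Fintype.card {x // x ∉ A.leaves} := Fintype.card_pos_iff.2 ⟨⟨r, hr⟩⟩
  have hN : 4 * Fintype.card {x // x ∉ A.leaves} + 2 * Fintype.card {x // x ∈ A.leaves} ≤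
      Fintype.card W + 4 := by
    rw [hW, hcardL]
    have h1 := Nat.le_ceil (9 / 2 * n - 5 / 2 * k - 9 / 2 : ℚ)
    have h2 : (n : ℚ) = Fintype.card {x // x ∉ A.leaves} + k := by exact_mod_cast hcard.symm
    have h3 : (1 : ℚ) ≤ Fintype.card {x // x ∉ A.leaves} := by exact_mod_cast hC
    have : (4 * Fintype.card {x // x ∉ A.leaves} + 2 * k : ℚ) ≤
        ⌈(9 / 2 * n - 5 / 2 * k - 9 / 2 : ℚ)⌉₊ + 4 := by linarith
    exact_mod_cast this
  obtain ⟨f, g, hf, hg, hfg, h1, h2, h3, h4⟩ := exists_rooted_embedding T.Adj hTtot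
    (⟨r, hr⟩ : {x // x ∉ A.leaves}) pC (fun u => G.dist (u : V) r)
    (fun u hu => by
      rw [hpC u (hner u hu)]
      exact (hπ _ (hner u hu)).2)
    (fun u => A.Adj (π u) u) par (fun x => A.Adj (π x) x)
    (fun u hu => by
      obtain ⟨c, hcr, hcu⟩ := hch u
      by_cases hc : c ∈ A.leaves
      · exact ⟨⟨c, hc⟩, Subtype.ext ((hpar _).trans hcu)⟩
      · refine absurd (Subtype.ext ?_) (hu ⟨c, hc⟩ fun h => hcr (congrArg Subtype.val h))
        exact (hpC ⟨c, hc⟩ hcr).trans hcu)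
    hN
  set F : V → W := fun x => if hx : x ∈ A.leaves then g ⟨x, hx⟩ else f ⟨x, hx⟩ with hF
  have hFC : ∀ u : {x // x ∉ A.leaves}, F u = f u := fun u => dif_neg u.2
  have hFL : ∀ x : {x // x ∈ A.leaves}, F x = g x := fun x => dif_pos x.2
  have hparent : ∀ c, c ≠ r → (A.Adj (π c) c → T.Adj (F (π c)) (F c)) ∧
      (¬ A.Adj (π c) c → T.Adj (F c) (F (π c))) := by
    intro c hcr
    by_cases hc : c ∈ A.leaves
    · rw [hFL ⟨c, hc⟩, ← hpar ⟨c, hc⟩, hFC]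
      rw [hpar ⟨c, hc⟩]
      exact ⟨h3 ⟨c, hc⟩, h4 ⟨c, hc⟩⟩
    · have hne' : (⟨c, hc⟩ : {x // x ∉ A.leaves}) ≠ ⟨r, hr⟩ :=
        fun h => hcr (congrArg Subtype.val h)
      rw [hFC ⟨c, hc⟩, ← hpC ⟨c, hc⟩ hcr, hFC]
      rw [hpC ⟨c, hc⟩ hcr]
      exact ⟨h1 ⟨c, hc⟩ hne', h2 ⟨c, hc⟩ hne'⟩
  refine ⟨F, ?_, ?_⟩
  · intro x y hxy
    by_cases hx : x ∈ A.leaves <;> by_cases hy : y ∈ A.leaves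
    · rw [hFL ⟨x, hx⟩, hFL ⟨y, hy⟩] at hxy
      exact congrArg Subtype.val (hg hxy)
    · rw [hFL ⟨x, hx⟩, hFC ⟨y, hy⟩] at hxy
      exact absurd hxy.symm (hfg _ _)
    · rw [hFC ⟨x, hx⟩, hFL ⟨y, hy⟩] at hxy
      exact absurd hxy (hfg _ _)
    · rw [hFC ⟨x, hx⟩, hFC ⟨y, hy⟩] at hxy
      exact congrArg Subtype.val (hf hxy)
  · intro x y hxy
    rcases hedge x y ((hGA x y).2 (Or.inl hxy)) with ⟨hxr, rfl⟩ | ⟨hyr, rfl⟩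
    · exact (hparent x hxr).2 (hAG _ _ hxy)
    · exact (hparent y hyr).1 hxy
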